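/- Let $p,q\in\mathbb R$ with $p>-1/2$. For $\beta>0$ and $N\ge 1$ let the generalised circular Jacobi $\beta$ ensemble be the probability density on $(-\pi,\pi]^N$ proportional to $$\prod_{l=1}^N e^{q\theta_l}\,|1+e^{i\theta_l}|^{\beta p}\prod_{1\le j<k\le N}|e^{i\theta_k}-e^{i\theta_j}|^{\beta},$$ let $p_N$ denote this normalised density, and let $$\rho_{(1),N}(\theta;\beta,p,q)=N\int_{(-\pi,\pi]^{N-1}}p_N(\theta,\theta_2,\dots,\theta_N)\,d\theta_2\cdots d\theta_N$$ be its one-point density. For $x\neq 0$ define the density scaled about the spectrum singularity at $\theta=\pm\pi$ by $$\rho_{(1),\infty}(x;\beta,p,q)=\lim_{N\to\infty}\frac{2\pi}{N}\,\rho_{(1),N}\Big(-\pi\,\mathrm{sgn}(x)+\frac{2\pi x}{N};\beta,p,q\Big).$$ Then for $\beta=2$ this limit exists for every real $x\ne0$, and the function $$R(x)=\frac1\pi\,\rho_{(1),\infty}\Big(\frac x\pi;2,p,q\Big)$$ is three times continuously differentiable on $\mathbb R\setminus\{0\}$ and satisfies there the third order linear differential equation $$x^3R'''(x)+4x^2R''(x)+2x\,(1-2p^2-4qx+2x^2)\,R'(x)-4\,(p^2+qx)\,R(x)=0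 .$$ -/

import Mathlib

open MeasureTheory Filter Topology

noncomputable section

/-- The weight `w(θ) = e^{q θ} |1 + e^{i θ}|^{β p}` of the generalised circular Jacobi
`β` ensemble, for `-π < θ ≤ π`. -/
def cJWeight (β p q θ : ℝ) : ℝ :=
  Real.exp (q * θ) * ‖1 + Complex.exp (Complex.I * θ)‖ ^ (β * p)

/-- The unnormalised joint eigenvalue density
`∏_l w(θ_l) ∏_{j < k} |e^{i θ_k} - e^{i θ_j}|^β`. -/
def cJUnnormalised (β p q : ℝ) (N : ℕ) (θ : Fin N → ℝ) : ℝ :=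
  (∏ l, cJWeight β p q (θ l)) *
    ∏ j, ∏ k ∈ Finset.Ioi j,
      ‖Complex.exp (Complex.I * θ k) - Complex.exp (Complex.I * θ j)‖ ^ β

/-- The box `(-π, π]^N`. -/
def angleBox (N : ℕ) : Set (Fin N → ℝ) :=
  Set.univ.pi fun _ => Set.Ioc (-Real.pi) Real.pi

/-- The normalisation constant of the joint eigenvalue density. -/
def cJPartition (β p q : ℝ) (N : ℕ) : ℝ :=
  ∫ θ in angleBox N, cJUnnormalised β p q N θ

/-- The joint eigenvalue probability density function on `(-π, π]^N`. -/
def cJPDF (β p q : ℝ) (N : ℕ) (θ : Fin N → ℝ) : ℝ :=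
  cJUnnormalised β p q N θ / cJPartition β p q N

/-- The one-point density
`ρ_{(1),N}(t) = N ∫_{(-π, π]^{N-1}} p_N(t, θ_2, …, θ_N) dθ_2 ⋯ dθ_N`
(equal to `0` for the empty ensemble `N = 0`). -/
def cJDensity (β p q : ℝ) : ℕ → ℝ → ℝ
  | 0, _ => 0
  | n + 1, t =>
      ((n + 1 : ℕ) : ℝ) * ∫ φ in angleBox n, cJPDF β p q (n + 1) (Fin.cons t φ)

/-- The finite-`N` density `(2π/N) ρ_{(1),N}(-π sgn x + 2π x/N)`, in the coordinate that is
centred at the spectrum singularity `θ = ±π` and has unit mean spacing. -/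
def cJRescaledDensity (β p q : ℝ) (N : ℕ) (x : ℝ) : ℝ :=
  2 * Real.pi / N *
    cJDensity β p q N (-Real.pi * Real.sign x + 2 * Real.pi * x / N)

/-- The bulk scaled density `ρ_{(1),∞}(x; β, p, q)`: the limit `N → ∞` of the rescaled
densities. -/
def cJBulkDensity (β p q x : ℝ) : ℝ :=
  limUnder atTop fun N : ℕ => cJRescaledDensity β p q N x

/-- The function `R(x) = (1/π) ρ_{(1),∞}(x/π; β, p, q)`. -/
def cJScaledDensity (β p q x : ℝ) : ℝ :=
  1 / Real.pi * cJBulkDensity β p q (x / Real.pi)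

end

/-!
For `β = 2` the ensemble is determinantal. Write `a = p - i q`, `b = p + i q`, `c = 2 p + 1` and
`ζ = -e^{iθ}`, so that the singularity of the weight `w` is at `ζ = 1`. The orthogonal polynomials
of `w` on the unit circle are `P_n(ζ) = ₂F₁(-n, a + 1; c; 1 - ζ)`, with reversed polynomials
`Q_n(ζ) = ₂F₁(-n, a; c; 1 - ζ)`. Both satisfy a Szegő recursion (`cJP_rec`, `cJQ_rec`). Integration
by parts gives the moments of `w` as products of two reciprocal Gamma functions (`cJMoment_eq`),
and an induction along the recursion then gives all moments of `P_n w` in closed form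
(`cJMean_cJP_cJQ`). Orthogonality and `∫ |P_n|² w = c₀ / d_n`, where `d_n = (c)_n / n!` and `c₀` is
the mass of `w`, can be read off. Andréief's identity turns the one-point density into
`(w / c₀) ∑_{k < N} d_k |P_k|²` (`cJDensity_eq`).

On the unit circle that sum has a closed form which is bilinear in `P_N`, `Q_N` and their
conjugates and contains no derivative (`cJ_christoffelDarboux`), so the limit of the density only
requires the limits of `P_N` and `Q_N` at `ζ = e^{2πix/N}`. These are `U = ₁F₁(a + 1; c; 2is)` and
`V = ₁F₁(a; c; 2is)` with `s = π x`, by dominated convergence of the series (`tendsto_hyperPoly`,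
`tendsto_cJRescaledDensity`).

As a function of `s` the limit has the form `R = ((s - q) g - Im T) / s`, where `g = E |U|²`,
`T = a E U conj V`, and `E` is a multiple of `|s|^{2p}` on each half-line. The first order system
for `U`, `V` (`cJ_exists_hasDerivAt`), together with `|U| = |V|` (`cJU_mul_conj_eq`), gives
`s g' = 2 Re T` and `s T' = 2 |a|² g + 2 i (s - q) T`. In particular `(s R)' = g`, and eliminating
`g` and `T` gives the third order equation (`thirdOrder_of_system`).
-/

/-! ### The weight and its moments -/

/-- The reflected point `ζ = -e^{iθ}` of the unit circle; the singularity `θ = ±π` of the weight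
sits at `ζ = 1`. -/
noncomputable def cJNode (θ : ℝ) : ℂ := -Complex.exp (Complex.I * θ)

/-- The one-particle reference measure: Lebesgue measure on `(-π, π]`. -/
noncomputable def cJArc : Measure ℝ := volume.restrict (Set.Ioc (-Real.pi) Real.pi)

instance : IsFiniteMeasure cJArc := by unfold cJArc; infer_instance

lemma cJNode_ne_zero (θ : ℝ) : cJNode θ ≠ 0 := neg_ne_zero.2 (Complex.exp_ne_zero _)

lemma norm_cJNode (θ : ℝ) : ‖cJNode θ‖ = 1 := by
  simp [cJNode, Complex.norm_exp]

lemma conj_cJNode (θ : ℝ) : (starRingEnd ℂ) (cJNode θ) = (cJNode θ)⁻¹ :=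
  (Complex.inv_eq_conj (norm_cJNode θ)).symm

@[fun_prop] lemma continuous_cJNode : Continuous cJNode := by
  unfold cJNode; fun_prop

lemma continuous_cJNode_zpow (m : ℤ) : Continuous fun θ => cJNode θ ^ m :=
  continuous_cJNode.zpow₀ m fun θ => Or.inl (cJNode_ne_zero θ)

lemma cJNode_zpow_neg (m : ℤ) (θ : ℝ) :
    cJNode θ ^ (-m) = (-1) ^ m * Complex.exp (-(m * (Complex.I * θ))) := by
  rw [cJNode, neg_eq_neg_one_mul, mul_zpow, ← Complex.exp_int_mul]
  congr 1
  · rw [zpow_neg, ← inv_zpow]; norm_num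
  · push_cast; ring_nf

lemma norm_one_add_exp (θ : ℝ) :
    ‖1 + Complex.exp (Complex.I * θ)‖ = |2 * Real.cos (θ / 2)| := by
  have h : 1 + Complex.exp (Complex.I * θ)
      = Complex.exp (((θ / 2 : ℝ) : ℂ) * Complex.I) * ((2 * Real.cos (θ / 2) : ℝ) : ℂ) := by
    push_cast
    rw [Complex.cos, mul_div_cancel₀ _ (two_ne_zero), mul_add, ← Complex.exp_add,
      ← Complex.exp_add]
    ring_nf
    simp [add_comm]
  rw [h, norm_mul, Complex.norm_exp_ofReal_mul_I, one_mul, Complex.norm_real, Real.norm_eq_abs]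

lemma two_cos_half_pos {θ : ℝ} (h : θ ∈ Set.Ioo (-Real.pi) Real.pi) :
    0 < 2 * Real.cos (θ / 2) := by
  have := Real.cos_pos_of_mem_Ioo (x := θ / 2) ⟨by linarith [h.1], by linarith [h.2]⟩
  linarith

lemma cJWeight_eq {p q θ : ℝ} (h : θ ∈ Set.Ioo (-Real.pi) Real.pi) :
    cJWeight 2 p q θ = Real.exp (q * θ) * (2 * Real.cos (θ / 2)) ^ (2 * p) := by
  rw [cJWeight, norm_one_add_exp, abs_of_pos (two_cos_half_pos h)]

lemma cJWeight_nonneg (β p q θ : ℝ) : 0 ≤ cJWeight β p q θ := by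
  unfold cJWeight; positivity

/-- The distance of `θ` to the nearer endpoint of `(-π, π)` bounds `2 cos (θ / 2)` from below up
to a constant; the power of the distance to the other endpoint is nonnegative. -/
lemma two_cos_half_rpow_le {r θ : ℝ} (hr : r ≤ 0) (h : θ ∈ Set.Ioo (-Real.pi) Real.pi) :
    (2 * Real.cos (θ / 2)) ^ r
      ≤ (2 / Real.pi) ^ r * ((Real.pi - θ) ^ r + (Real.pi + θ) ^ r) := by
  have hπ := Real.pi_pos
  obtain ⟨h1, h2⟩ := h
  have hA : 0 ≤ (Real.pi - θ) ^ r := Real.rpow_nonneg (by linarith) _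
  have hB : 0 ≤ (Real.pi + θ) ^ r := Real.rpow_nonneg (by linarith) _
  have hC : 0 ≤ (2 / Real.pi) ^ r := by positivity
  rcases le_total 0 θ with h0 | h0
  · have hc := Real.one_sub_mul_le_cos (x := θ / 2) (by linarith) (by linarith)
    have hb : 2 / Real.pi * (Real.pi - θ) ≤ 2 * Real.cos (θ / 2) := by
      have : 2 / Real.pi * (Real.pi - θ) = 2 * (1 - 2 / Real.pi * (θ / 2)) := by
        field_simp
      linarith
    have hp : 0 < 2 / Real.pi * (Real.pi - θ) := by
      have : 0 < Real.pi - θ := by linarith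
      positivity
    have := Real.rpow_le_rpow_of_nonpos hp hb hr
    rw [Real.mul_rpow (x := 2 / Real.pi) (by positivity) (by linarith)] at this
    nlinarith [mul_nonneg hC hB]
  · have hc := Real.one_add_mul_le_cos (x := θ / 2) (by linarith) (by linarith)
    have hb : 2 / Real.pi * (Real.pi + θ) ≤ 2 * Real.cos (θ / 2) := by
      have : 2 / Real.pi * (Real.pi + θ) = 2 * (1 + 2 / Real.pi * (θ / 2)) := by
        field_simp
      linarith
    have hp : 0 < 2 / Real.pi * (Real.pi + θ) := by
      have : 0 < Real.pi + θ := by linarith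
      positivity
    have := Real.rpow_le_rpow_of_nonpos hp hb hr
    rw [Real.mul_rpow (x := 2 / Real.pi) (by positivity) (by linarith)] at this
    nlinarith [mul_nonneg hC hA]

lemma integrableOn_two_cos_half_rpow {r : ℝ} (hr : -1 < r) :
    IntegrableOn (fun θ => (2 * Real.cos (θ / 2)) ^ r) (Set.Ioo (-Real.pi) Real.pi) := by
  have hπ := Real.pi_pos
  rcases le_total 0 r with h0 | h0
  · refine IntegrableOn.mono_set (t := Set.Icc (-Real.pi) Real.pi) ?_ Set.Ioo_subset_Icc_self
    refine (Continuous.continuousOn ?_).integrableOn_compact isCompact_Icc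
    exact Continuous.rpow_const (by fun_prop) fun _ => Or.inr h0
  · have i1 : IntervalIntegrable (fun θ => (Real.pi - θ) ^ r) volume (-Real.pi) Real.pi := by
      have := (intervalIntegral.intervalIntegrable_rpow' (a := 2 * Real.pi) (b := 0)
        hr).comp_sub_left Real.pi
      convert this using 1 <;> ring
    have i2 : IntervalIntegrable (fun θ => (Real.pi + θ) ^ r) volume (-Real.pi) Real.pi := by
      have := (intervalIntegral.intervalIntegrable_rpow' (a := 0) (b := 2 * Real.pi)
        hr).comp_add_left Real.pi
      convert this using 1 <;> ring
    have i3 := ((i1.add i2).const_mul ((2 / Real.pi) ^ r)).1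
    refine Integrable.mono' (i3.mono_set Set.Ioo_subset_Ioc_self) ?_ ?_
    · exact Measurable.aestronglyMeasurable (by fun_prop)
    · refine (ae_restrict_iff' measurableSet_Ioo).2 (ae_of_all _ fun θ hθ => ?_)
      rw [Real.norm_of_nonneg (Real.rpow_nonneg (two_cos_half_pos hθ).le _)]
      exact two_cos_half_rpow_le h0 hθ

lemma integrableOn_cJWeight {p : ℝ} (q : ℝ) (hp : -(1 / 2) < p) :
    IntegrableOn (cJWeight 2 p q) (Set.Icc (-Real.pi) Real.pi) := by
  have h := integrableOn_two_cos_half_rpow (r := 2 * p) (by linarith)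
  have h' : IntegrableOn (fun θ => (2 * Real.cos (θ / 2)) ^ (2 * p))
      (Set.Icc (-Real.pi) Real.pi) := by
    rwa [integrableOn_Icc_iff_integrableOn_Ioo]
  have h2 := IntegrableOn.continuousOn_mul (g := fun θ => Real.exp (q * θ)) (by fun_prop) h'
    isCompact_Icc
  rw [integrableOn_Icc_iff_integrableOn_Ioo] at h2 ⊢
  exact h2.congr_fun (fun θ hθ => (cJWeight_eq hθ).symm) measurableSet_Ioo

lemma integrable_cJWeight_mul {p : ℝ} (q : ℝ) (hp : -(1 / 2) < p) {f : ℝ → ℂ}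
    (hf : Continuous f) : Integrable (fun θ => (cJWeight 2 p q θ : ℂ) * f θ) cJArc := by
  have h : IntegrableOn (fun θ => (cJWeight 2 p q θ : ℂ)) (Set.Icc (-Real.pi) Real.pi) :=
    (integrableOn_cJWeight q hp).ofReal
  exact (h.mul_continuousOn hf.continuousOn isCompact_Icc).mono_set Set.Ioc_subset_Icc_self

/-- The (unnormalised) weighted integral `∫ f(θ) w(θ) dθ` over the circle, with `β = 2`. -/
noncomputable def cJMean (p q : ℝ) (f : ℝ → ℂ) : ℂ :=
  ∫ θ, (cJWeight 2 p q θ : ℂ) * f θ ∂cJArc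

/-- The total mass `∫ w(θ) dθ` of the weight. -/
noncomputable def cJMass (p q : ℝ) : ℝ := ∫ θ, cJWeight 2 p q θ ∂cJArc

lemma cJMean_one (p q : ℝ) : cJMean p q (fun _ => 1) = cJMass p q := by
  simp only [cJMean, cJMass, mul_one]
  exact integral_ofReal

lemma cJMass_pos {p : ℝ} (q : ℝ) (hp : -(1 / 2) < p) : 0 < cJMass p q := by
  have hi : Integrable (cJWeight 2 p q) cJArc :=
    (integrableOn_cJWeight q hp).mono_set Set.Ioc_subset_Icc_self
  rw [cJMass, integral_pos_iff_support_of_nonneg (cJWeight_nonneg 2 p q) hi]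
  have hsub : Set.Ioo (-Real.pi) Real.pi ⊆ Function.support (cJWeight 2 p q) := by
    intro θ hθ
    rw [Function.mem_support, cJWeight_eq hθ]
    have := two_cos_half_pos hθ
    positivity
  have hm : 0 < cJArc (Set.Ioo (-Real.pi) Real.pi) := by
    rw [cJArc, Measure.restrict_apply measurableSet_Ioo,
      Set.inter_eq_left.2 Set.Ioo_subset_Ioc_self, Real.volume_Ioo]
    simp [Real.pi_pos]
  exact hm.trans_le (measure_mono hsub)

lemma cJMean_add {p : ℝ} (q : ℝ) (hp : -(1 / 2) < p) {f g : ℝ → ℂ} (hf : Continuous f)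
    (hg : Continuous g) :
    cJMean p q (fun θ => f θ + g θ) = cJMean p q f + cJMean p q g := by
  simp only [cJMean, mul_add]
  exact integral_add (integrable_cJWeight_mul q hp hf) (integrable_cJWeight_mul q hp hg)

lemma cJMean_const_mul (p q : ℝ) (k : ℂ) (f : ℝ → ℂ) :
    cJMean p q (fun θ => k * f θ) = k * cJMean p q f := by
  simp only [cJMean]
  rw [← integral_const_mul]
  congr 1; ext θ; ring

lemma cJMean_sum {p : ℝ} (q : ℝ) (hp : -(1 / 2) < p) {ι : Type*} (s : Finset ι)
    {f : ι → ℝ → ℂ} (hf : ∀ i ∈ s, Continuous (f i)) :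
    cJMean p q (fun θ => ∑ i ∈ s, f i θ) = ∑ i ∈ s, cJMean p q (f i) := by
  simp only [cJMean, Finset.mul_sum]
  exact integral_finsetSum _ fun i hi => integrable_cJWeight_mul q hp (hf i hi)

lemma cJMean_conj (p q : ℝ) (f : ℝ → ℂ) :
    cJMean p q (fun θ => (starRingEnd ℂ) (f θ)) = (starRingEnd ℂ) (cJMean p q f) := by
  simp only [cJMean]
  rw [← integral_conj]
  simp

/-- The trigonometric moments `∫ ζ^{-m} w dθ`. -/
noncomputable def cJMoment (p q : ℝ) (m : ℤ) : ℂ := cJMean p q fun θ => cJNode θ ^ (-m)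

/-- The derivative of `e^{-imθ} (1 + e^{iθ}) w(θ)`. The function is written with
`1 + e^{iθ} = 2 cos (θ / 2) e^{iθ/2}`, in which form it is continuous up to `±π`. -/
lemma hasDerivAt_boundary_term (p q : ℝ) (m : ℤ) {θ : ℝ} (h : θ ∈ Set.Ioo (-Real.pi) Real.pi) :
    HasDerivAt (fun θ : ℝ => Complex.exp ((q + Complex.I / 2 - Complex.I * m) * θ) *
        (((2 * Real.cos (θ / 2)) ^ (2 * p + 1) : ℝ) : ℂ))
      ((cJWeight 2 p q θ : ℂ) * (Complex.I * ((1 + (p - Complex.I * q) - m) *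
        Complex.exp (-((m - 1 : ℤ) * (Complex.I * θ)))
          - (m + (p + Complex.I * q)) * Complex.exp (-(m * (Complex.I * θ)))))) θ := by
  have hc := two_cos_half_pos h
  have h1 : HasDerivAt (fun θ : ℝ => Complex.exp ((q + Complex.I / 2 - Complex.I * m) * θ))
      (Complex.exp ((q + Complex.I / 2 - Complex.I * m) * θ) *
        (q + Complex.I / 2 - Complex.I * m)) θ := by
    have := ((hasDerivAt_id (θ : ℂ)).const_mul (q + Complex.I / 2 - Complex.I * m)).cexp
    simpa using this.comp_ofReal
  have h2 : HasDerivAt (fun θ : ℝ => (2 * Real.cos (θ / 2)) ^ (2 * p + 1))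
      (-Real.sin (θ / 2) * (2 * p + 1) * (2 * Real.cos (θ / 2)) ^ (2 * p)) θ := by
    have h3 : HasDerivAt (fun θ : ℝ => 2 * Real.cos (θ / 2)) (-Real.sin (θ / 2)) θ := by
      have := (((hasDerivAt_id θ).div_const 2).cos).const_mul 2
      refine this.congr_deriv ?_
      simp; ring
    have := h3.rpow_const (p := 2 * p + 1) (Or.inl hc.ne')
    simpa using this
  refine (h1.mul h2.ofReal_comp).congr_deriv ?_
  rw [cJWeight_eq h, Real.rpow_add_one hc.ne']
  set W : ℝ := (2 * Real.cos (θ / 2)) ^ (2 * p)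
  set E := Complex.exp (Complex.I * θ / 2) with hE
  have hE0 : E ≠ 0 := Complex.exp_ne_zero _
  have e1 : Complex.exp ((q + Complex.I / 2 - Complex.I * m) * θ)
      = ((Real.exp (q * θ) : ℝ) : ℂ) * E * Complex.exp (-(m * (Complex.I * θ))) := by
    rw [Complex.ofReal_exp, hE, ← Complex.exp_add, ← Complex.exp_add]
    push_cast; ring_nf
  have e2 : Complex.exp (-((m - 1 : ℤ) * (Complex.I * θ)))
      = E ^ 2 * Complex.exp (-(m * (Complex.I * θ))) := by
    rw [hE, ← Complex.exp_nat_mul, ← Complex.exp_add]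
    push_cast; ring_nf
  have e3 : ((Real.cos (θ / 2) : ℝ) : ℂ) = (E + E⁻¹) / 2 := by
    rw [Complex.ofReal_cos, Complex.cos, hE, ← Complex.exp_neg]
    push_cast; ring_nf
  have e4 : ((Real.sin (θ / 2) : ℝ) : ℂ) = (E⁻¹ - E) * Complex.I / 2 := by
    rw [Complex.ofReal_sin, Complex.sin, hE, ← Complex.exp_neg]
    push_cast; ring_nf
  rw [e1, e2]
  push_cast [e3, e4] at *
  rw [e3, e4]
  field_simp
  ring_nf
  simp only [Complex.I_sq]
  ring

lemma continuous_boundary_term {p : ℝ} (q : ℝ) (hp : -(1 / 2) < p) (m : ℤ) :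
    Continuous (fun θ : ℝ => Complex.exp ((q + Complex.I / 2 - Complex.I * m) * θ) *
        (((2 * Real.cos (θ / 2)) ^ (2 * p + 1) : ℝ) : ℂ)) := by
  have : Continuous fun θ : ℝ => (2 * Real.cos (θ / 2)) ^ (2 * p + 1) :=
    Continuous.rpow_const (by fun_prop) fun _ => Or.inr (by linarith)
  fun_prop

/-- Integrating by parts, the moments satisfy a first order recurrence; the boundary terms vanish
because `2 p + 1 > 0`. -/
lemma cJMoment_rec {p : ℝ} (q : ℝ) (hp : -(1 / 2) < p) (m : ℤ) :
    (1 + (p - Complex.I * q) - m) * cJMoment p q (m - 1)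
      = -(m + (p + Complex.I * q)) * cJMoment p q m := by
  have hπ := Real.pi_pos
  set F : ℝ → ℂ := fun θ => Complex.I * ((1 + (p - Complex.I * q) - m) *
        Complex.exp (-((m - 1 : ℤ) * (Complex.I * θ)))
          - (m + (p + Complex.I * q)) * Complex.exp (-(m * (Complex.I * θ)))) with hF
  have hFc : Continuous F := by fun_prop
  have hint : IntervalIntegrable (fun θ => (cJWeight 2 p q θ : ℂ) * F θ) volume
      (-Real.pi) Real.pi :=
    (intervalIntegrable_iff_integrableOn_Ioc_of_le (by linarith)).2
      (integrable_cJWeight_mul q hp hFc)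
  have key := intervalIntegral.integral_eq_sub_of_hasDerivAt_of_le (by linarith)
    (continuous_boundary_term q hp m).continuousOn
    (fun θ hθ => hasDerivAt_boundary_term p q m hθ) hint
  have hb : (2 * p + 1) ≠ 0 := by linarith
  have hz : cJMean p q F = 0 := by
    rw [intervalIntegral.integral_of_le (by linarith)] at key
    refine key.trans ?_
    simp [neg_div, Real.zero_rpow hb]
  have hexp : ∀ (k : ℤ) (θ : ℝ), Complex.exp (-(k * (Complex.I * θ)))
      = (-1) ^ k * cJNode θ ^ (-k) := by
    intro k θ
    have h1 : ((-1 : ℂ)) ^ k * (-1) ^ k = 1 := by rw [← mul_zpow]; norm_num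
    rw [cJNode_zpow_neg]
    linear_combination -Complex.exp (-(k * (Complex.I * θ))) * h1
  have hF2 : F = fun θ => (Complex.I * (1 + (p - Complex.I * q) - m) * (-1) ^ (m - 1)) *
      cJNode θ ^ (-(m - 1)) + (-Complex.I * (m + (p + Complex.I * q)) * (-1) ^ m) *
      cJNode θ ^ (-m) := by
    ext θ
    simp only [hF, hexp]
    ring
  have hcont : ∀ (k : ℂ) (j : ℤ), Continuous fun θ => k * cJNode θ ^ j :=
    fun k j => continuous_const.mul (continuous_cJNode_zpow j)
  rw [hF2, cJMean_add q hp (hcont _ _) (hcont _ _), cJMean_const_mul, cJMean_const_mul] at hz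
  have hs : ((-1 : ℂ)) ^ (m - 1) = -(-1) ^ m := by
    rw [zpow_sub_one₀ (by norm_num)]; norm_num
  rw [hs] at hz
  change _ * cJMoment p q (m - 1) + _ * cJMoment p q m = 0 at hz
  have hne : (-1 : ℂ) ^ m * Complex.I ≠ 0 :=
    mul_ne_zero (zpow_ne_zero _ (by norm_num)) Complex.I_ne_zero
  refine mul_left_cancel₀ hne ?_
  linear_combination -hz

/-- The constant `K` in the closed form of the moments, `c₀ Γ(a + 1) Γ(b + 1)` with
`a = p - i q` and `b = p + i q`. -/
noncomputable def cJMomentConst (p q : ℝ) : ℂ :=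
  cJMass p q * (Complex.Gamma (p - Complex.I * q + 1) * Complex.Gamma (p + Complex.I * q + 1))

/-- Closed form of the moments. The reciprocal Gamma function is entire, with Mathlib's
`Γ(-n)⁻¹ = 0` at the poles, so no case distinction on integer exponents is needed. -/
lemma cJMoment_eq {p : ℝ} (q : ℝ) (hp : -(1 / 2) < p) (m : ℤ) :
    cJMoment p q m = (-1) ^ m * cJMomentConst p q *
      (Complex.Gamma (p - Complex.I * q - m + 1))⁻¹ *
      (Complex.Gamma (p + Complex.I * q + m + 1))⁻¹ := by
  induction m using Int.induction_on with
  | zero =>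
    have hg1 : Complex.Gamma (p - Complex.I * q + 1) ≠ 0 :=
      Complex.Gamma_ne_zero_of_re_pos (by simp; linarith)
    have hg2 : Complex.Gamma (p + Complex.I * q + 1) ≠ 0 :=
      Complex.Gamma_ne_zero_of_re_pos (by simp; linarith)
    have : cJMoment p q 0 = cJMass p q := by
      rw [← cJMean_one]; simp [cJMoment]
    rw [this, cJMomentConst]
    simp only [Int.cast_zero, sub_zero, add_zero, zpow_zero]
    field_simp
  | succ i ih =>
    have hr := cJMoment_rec q hp (i + 1)
    rw [add_sub_cancel_right, ih] at hr
    have hne : (((i + 1 : ℤ) : ℂ) + (p + Complex.I * q)) ≠ 0 := by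
      intro h0
      have := congrArg Complex.re h0
      simp at this
      have hi : (0 : ℝ) ≤ i := i.cast_nonneg
      linarith
    refine mul_left_cancel₀ (neg_ne_zero.2 hne) ?_
    rw [← hr, zpow_add_one₀ (by norm_num)]
    have g1 := Complex.one_div_Gamma_eq_self_mul_one_div_Gamma_add_one
      (p - Complex.I * q - ((i + 1 : ℤ) : ℂ) + 1)
    have g2 := Complex.one_div_Gamma_eq_self_mul_one_div_Gamma_add_one
      (p + Complex.I * q + ((i : ℤ) : ℂ) + 1)
    have a1 : (p - Complex.I * q - ((i + 1 : ℤ) : ℂ) + 1 + 1)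
      = p - Complex.I * q - ((i : ℤ) : ℂ) + 1 := by push_cast; ring
    have a2 : (p + Complex.I * q + ((i : ℤ) : ℂ) + 1 + 1)
      = p + Complex.I * q + ((i + 1 : ℤ) : ℂ) + 1 := by push_cast; ring
    rw [a1] at g1
    rw [a2] at g2
    rw [g1, g2]
    push_cast
    ring
  | pred i ih =>
    have hr := cJMoment_rec q hp (-i)
    rw [ih] at hr
    have hne : (1 + (p - Complex.I * q) - ((-i : ℤ) : ℂ)) ≠ 0 := by
      intro h0
      have := congrArg Complex.re h0
      simp at this
      have hi : (0 : ℝ) ≤ i := i.cast_nonneg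
      linarith
    refine mul_left_cancel₀ hne ?_
    rw [hr, zpow_sub_one₀ (by norm_num)]
    have g1 := Complex.one_div_Gamma_eq_self_mul_one_div_Gamma_add_one
      (p - Complex.I * q - ((-i : ℤ) : ℂ) + 1)
    have g2 := Complex.one_div_Gamma_eq_self_mul_one_div_Gamma_add_one
      (p + Complex.I * q + ((-i - 1 : ℤ) : ℂ) + 1)
    have a1 : (p - Complex.I * q - ((-i : ℤ) : ℂ) + 1 + 1)
      = p - Complex.I * q - ((-i - 1 : ℤ) : ℂ) + 1 := by push_cast; ring
    have a2 : (p + Complex.I * q + ((-i - 1 : ℤ) : ℂ) + 1 + 1)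
      = p + Complex.I * q + ((-i : ℤ) : ℂ) + 1 := by push_cast; ring
    rw [a1] at g1
    rw [a2] at g2
    rw [g1, g2]
    push_cast
    ring

/-! ### Hypergeometric polynomials and the Szegő recursion -/

/-- The ratio `(α)_k / (c)_k` of Pochhammer symbols `(α)_k = α (α + 1) ⋯ (α + k - 1)`. -/
noncomputable def pochRatio (α c : ℂ) (k : ℕ) : ℂ := ∏ j ∈ Finset.range k, (α + j) / (c + j)

lemma pochRatio_zero (α c : ℂ) : pochRatio α c 0 = 1 := by simp [pochRatio]

lemma pochRatio_succ (α c : ℂ) (k : ℕ) :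
    pochRatio α c (k + 1) = pochRatio α c k * ((α + k) / (c + k)) := by
  rw [pochRatio, Finset.prod_range_succ]; rfl

/-- `(a)_{k+1} = a (a+1)_k`, divided by `(c)_{k+1}`. -/
lemma pochRatio_succ' (a c : ℂ) (k : ℕ) :
    pochRatio a c (k + 1) = a / (c + k) * pochRatio (a + 1) c k := by
  simp only [pochRatio, Finset.prod_div_distrib]
  rw [Finset.prod_range_succ' (fun j : ℕ => a + (j : ℂ)),
    Finset.prod_range_succ (fun j : ℕ => c + (j : ℂ))]
  have : ∀ k : ℕ, (a + ((k + 1 : ℕ) : ℂ)) = a + 1 + k := fun k => by push_cast; ring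
  simp only [this, Nat.cast_zero, add_zero]
  rw [div_mul_div_comm]
  ring_nf

/-- The hypergeometric polynomial `₂F₁(-n, α; c; 1 - ζ) = ∑_k C(n,k) (α)_k/(c)_k (ζ - 1)^k`. -/
noncomputable def hyperPoly (α c : ℂ) (n : ℕ) (ζ : ℂ) : ℂ :=
  ∑ k ∈ Finset.range (n + 1), (n.choose k : ℂ) * pochRatio α c k * (ζ - 1) ^ k

lemma hyperPoly_zero (α c ζ : ℂ) : hyperPoly α c 0 ζ = 1 := by
  simp [hyperPoly, pochRatio]

@[fun_prop] lemma continuous_hyperPoly (α c : ℂ) (n : ℕ) : Continuous (hyperPoly α c n) := by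
  unfold hyperPoly; fun_prop

lemma hyperPoly_eq_sum_of_le (α c ζ : ℂ) {n N : ℕ} (h : n + 1 ≤ N) :
    hyperPoly α c n ζ
      = ∑ k ∈ Finset.range N, (n.choose k : ℂ) * pochRatio α c k * (ζ - 1) ^ k := by
  refine Finset.sum_subset (Finset.range_mono h) fun k _ hk => ?_
  rw [Finset.mem_range, not_lt] at hk
  rw [Nat.choose_eq_zero_of_lt (by omega)]
  simp

/-- The sum for degree `n`, with its constant term split off, and padded by a vanishing term. -/
lemma hyperPoly_eq_head_add (α c ζ : ℂ) (n : ℕ) :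
    hyperPoly α c n ζ = 1 + ∑ k ∈ Finset.range (n + 1),
      (n.choose (k + 1) : ℂ) * pochRatio α c (k + 1) * (ζ - 1) ^ (k + 1) := by
  rw [hyperPoly_eq_sum_of_le α c ζ (N := n + 1 + 1) (by omega), Finset.sum_range_succ']
  simp [pochRatio_zero, add_comm]

/-- `(k + 1) C(n, k + 1) = (n - k) C(n, k)` without truncated subtraction. -/
lemma choose_succ_mul_cast (n k : ℕ) :
    ((n.choose (k + 1) : ℂ)) * (k + 1) = (n.choose k : ℂ) * (n - k) := by
  rcases le_or_gt k n with h | h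
  · have := Nat.choose_succ_right_eq n k
    have h2 := congrArg (Nat.cast : ℕ → ℂ) this
    push_cast [Nat.cast_sub h] at h2
    exact h2
  · rw [Nat.choose_eq_zero_of_lt h, Nat.choose_eq_zero_of_lt (by omega)]; simp

/-- First half of the Szegő recursion for the hypergeometric polynomials. -/
lemma hyperPoly_rec_left {a b : ℂ} (hc : ∀ j : ℕ, a + b + 1 + j ≠ 0) (n : ℕ) (ζ : ℂ) :
    (n + (a + b + 1)) * hyperPoly (a + 1) (a + b + 1) (n + 1) ζ
      = b * hyperPoly a (a + b + 1) n ζ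
        + (n + 1 + a) * ζ * hyperPoly (a + 1) (a + b + 1) n ζ := by
  set c := a + b + 1 with hcdef
  have hz : ∀ x : ℂ, (n + 1 + a) * ζ * x = (n + 1 + a) * x + (n + 1 + a) * ((ζ - 1) * x) :=
    fun x => by ring
  rw [hz]
  have e1 : hyperPoly (a + 1) c (n + 1) ζ = 1 + ∑ k ∈ Finset.range (n + 1),
      ((n + 1).choose (k + 1) : ℂ) * pochRatio (a + 1) c (k + 1) * (ζ - 1) ^ (k + 1) := by
    rw [hyperPoly, Finset.sum_range_succ']
    simp [pochRatio_zero, add_comm]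
  rw [e1, hyperPoly_eq_head_add a, hyperPoly_eq_head_add (a + 1) c ζ n]
  have e2 : (ζ - 1) * (1 + ∑ k ∈ Finset.range (n + 1),
      (n.choose (k + 1) : ℂ) * pochRatio (a + 1) c (k + 1) * (ζ - 1) ^ (k + 1))
      = ∑ k ∈ Finset.range (n + 1), (n.choose k : ℂ) * pochRatio (a + 1) c k
        * (ζ - 1) ^ (k + 1) := by
    rw [← hyperPoly_eq_head_add (a + 1) c ζ n, hyperPoly, Finset.mul_sum]
    refine Finset.sum_congr rfl fun k _ => by ring
  rw [e2]
  simp only [mul_add, Finset.mul_sum]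
  have : ∀ s1 s2 s3 s4 : ℂ, s1 = s2 + s3 + s4 →
      (n + c) * 1 + s1 = b * 1 + s2 + ((n + 1 + a) * 1 + s3 + s4) := by
    intro s1 s2 s3 s4 h
    rw [h, hcdef]; ring
  apply this
  rw [← Finset.sum_add_distrib, ← Finset.sum_add_distrib]
  refine Finset.sum_congr rfl fun k _ => ?_
  have hk := hc k
  rw [pochRatio_succ' a c k, pochRatio_succ (a + 1) c k, Nat.choose_succ_succ']
  push_cast
  have hch := choose_succ_mul_cast n k
  field_simp
  rw [hcdef]
  linear_combination pochRatio (a + 1) (a + b + 1) k * b * (ζ - 1) ^ (k + 1) * hch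

/-- Second half of the Szegő recursion for the hypergeometric polynomials. -/
lemma hyperPoly_rec_right {a b : ℂ} (hc : ∀ j : ℕ, a + b + 1 + j ≠ 0) (n : ℕ) (ζ : ℂ) :
    (n + (a + b + 1)) * hyperPoly a (a + b + 1) (n + 1) ζ
      = a * ζ * hyperPoly (a + 1) (a + b + 1) n ζ
        + (n + 1 + b) * hyperPoly a (a + b + 1) n ζ := by
  set c := a + b + 1 with hcdef
  have hz : ∀ x : ℂ, a * ζ * x = a * x + a * ((ζ - 1) * x) :=
    fun x => by ring
  rw [hz]
  have e1 : hyperPoly a c (n + 1) ζ = 1 + ∑ k ∈ Finset.range (n + 1),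
      ((n + 1).choose (k + 1) : ℂ) * pochRatio a c (k + 1) * (ζ - 1) ^ (k + 1) := by
    rw [hyperPoly, Finset.sum_range_succ']
    simp [pochRatio_zero, add_comm]
  rw [e1, hyperPoly_eq_head_add a, hyperPoly_eq_head_add (a + 1) c ζ n]
  have e2 : (ζ - 1) * (1 + ∑ k ∈ Finset.range (n + 1),
      (n.choose (k + 1) : ℂ) * pochRatio (a + 1) c (k + 1) * (ζ - 1) ^ (k + 1))
      = ∑ k ∈ Finset.range (n + 1), (n.choose k : ℂ) * pochRatio (a + 1) c k
        * (ζ - 1) ^ (k + 1) := by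
    rw [← hyperPoly_eq_head_add (a + 1) c ζ n, hyperPoly, Finset.mul_sum]
    refine Finset.sum_congr rfl fun k _ => by ring
  rw [e2]
  simp only [mul_add, Finset.mul_sum]
  have : ∀ s1 s2 s3 s4 : ℂ, s1 = s2 + s3 + s4 →
      (n + c) * 1 + s1 = a * 1 + s2 + s3 + ((n + 1 + b) * 1 + s4) := by
    intro s1 s2 s3 s4 h
    rw [h, hcdef]; ring
  apply this
  rw [← Finset.sum_add_distrib, ← Finset.sum_add_distrib]
  refine Finset.sum_congr rfl fun k _ => ?_
  have hk := hc k
  rw [pochRatio_succ' a c k, pochRatio_succ (a + 1) c k, Nat.choose_succ_succ']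
  push_cast
  have hch := choose_succ_mul_cast n k
  field_simp
  rw [hcdef]
  linear_combination (-1) * pochRatio (a + 1) (a + b + 1) k * a * (ζ - 1) ^ (k + 1) * hch

/-- On the unit circle, where `ζ⁻¹` and conjugation agree, the two polynomials have the same
modulus when `b` is the conjugate of `a`. -/
lemma norm_hyperPoly_eq {a b ζ : ℂ} (hab : (starRingEnd ℂ) a = b)
    (hc : ∀ j : ℕ, a + b + 1 + j ≠ 0) (hζ : ‖ζ‖ = 1) (n : ℕ) :
    hyperPoly (a + 1) (a + b + 1) n ζ * (starRingEnd ℂ) (hyperPoly (a + 1) (a + b + 1) n ζ)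
      = hyperPoly a (a + b + 1) n ζ * (starRingEnd ℂ) (hyperPoly a (a + b + 1) n ζ) := by
  have hba : (starRingEnd ℂ) b = a := by rw [← hab, Complex.conj_conj]
  have hzz : ζ * (starRingEnd ℂ) ζ = 1 := by
    rw [Complex.mul_conj, Complex.normSq_eq_norm_sq, hζ]; simp
  induction n with
  | zero => simp [hyperPoly_zero]
  | succ n ih =>
    have r1 := hyperPoly_rec_left hc n ζ
    have r2 := hyperPoly_rec_right hc n ζ
    have s1 := congrArg (starRingEnd ℂ) r1
    have s2 := congrArg (starRingEnd ℂ) r2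
    simp only [map_add, map_mul, map_natCast, map_one, hab, hba] at s1 s2
    have hn : (n + (a + b + 1) : ℂ) ≠ 0 := by rw [add_comm]; exact hc n
    have hn2 : ((n + (a + b + 1)) * (n + (b + a + 1)) : ℂ) ≠ 0 := by
      rw [add_comm b a]; exact mul_ne_zero hn hn
    refine mul_left_cancel₀ hn2 ?_
    set P := hyperPoly (a + 1) (a + b + 1) n ζ
    set Q := hyperPoly a (a + b + 1) n ζ
    have t1 := congrArg₂ (· * ·) r1 s1
    have t2 := congrArg₂ (· * ·) r2 s2
    set P1 := hyperPoly (a + 1) (a + b + 1) (n + 1) ζ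
    set Q1 := hyperPoly a (a + b + 1) (n + 1) ζ
    linear_combination t1 - t2 + ((n + 1 + a) * (n + 1 + b) - a * b) * ih
      + ((n + 1 + a) * (n + 1 + b) - a * b) * P * (starRingEnd ℂ) P * hzz

/-! ### Orthogonality and norms -/

/-- The circular Jacobi orthogonal polynomials in `ζ = -e^{iθ}`, normalised to `1` at the
singularity `ζ = 1`. -/
noncomputable def cJP (p q : ℝ) (n : ℕ) (ζ : ℂ) : ℂ :=
  hyperPoly (p - Complex.I * q + 1) (2 * p + 1) n ζ

/-- The reversed polynomials `ζ^n conj (P_n(ζ))`, `|ζ| = 1`. -/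
noncomputable def cJQ (p q : ℝ) (n : ℕ) (ζ : ℂ) : ℂ :=
  hyperPoly (p - Complex.I * q) (2 * p + 1) n ζ

lemma cJ_add_eq (p q : ℝ) :
    (p - Complex.I * q : ℂ) + (p + Complex.I * q) + 1 = 2 * p + 1 := by ring

lemma cJ_conj (p q : ℝ) :
    (starRingEnd ℂ) (p - Complex.I * q : ℂ) = p + Complex.I * q := by simp

lemma cJ_two_p_add_ne_zero {p : ℝ} (hp : -(1 / 2) < p) (j : ℕ) : (2 * p + 1 + j : ℂ) ≠ 0 := by
  have h : (0 : ℝ) < 2 * p + 1 + j := by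
    have : (0 : ℝ) ≤ j := j.cast_nonneg
    linarith
  exact_mod_cast h.ne'

lemma cJ_param_ne_zero {p : ℝ} (q : ℝ) (hp : -(1 / 2) < p) (j : ℕ) :
    (p - Complex.I * q : ℂ) + (p + Complex.I * q) + 1 + j ≠ 0 := by
  rw [cJ_add_eq]; exact cJ_two_p_add_ne_zero hp j

lemma cJP_zero (p q : ℝ) (ζ : ℂ) : cJP p q 0 ζ = 1 := hyperPoly_zero _ _ _
lemma cJQ_zero (p q : ℝ) (ζ : ℂ) : cJQ p q 0 ζ = 1 := hyperPoly_zero _ _ _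

@[fun_prop] lemma continuous_cJP (p q : ℝ) (n : ℕ) : Continuous (cJP p q n) :=
  continuous_hyperPoly _ _ _
@[fun_prop] lemma continuous_cJQ (p q : ℝ) (n : ℕ) : Continuous (cJQ p q n) :=
  continuous_hyperPoly _ _ _

lemma cJP_rec {p : ℝ} (q : ℝ) (hp : -(1 / 2) < p) (n : ℕ) (ζ : ℂ) :
    (n + (2 * p + 1)) * cJP p q (n + 1) ζ
      = (p + Complex.I * q) * cJQ p q n ζ
        + (n + 1 + (p - Complex.I * q)) * ζ * cJP p q n ζ := by
  have := hyperPoly_rec_left (cJ_param_ne_zero q hp) n ζ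
  rwa [cJ_add_eq] at this

lemma cJQ_rec {p : ℝ} (q : ℝ) (hp : -(1 / 2) < p) (n : ℕ) (ζ : ℂ) :
    (n + (2 * p + 1)) * cJQ p q (n + 1) ζ
      = (p - Complex.I * q) * ζ * cJP p q n ζ
        + (n + 1 + (p + Complex.I * q)) * cJQ p q n ζ := by
  have := hyperPoly_rec_right (cJ_param_ne_zero q hp) n ζ
  rwa [cJ_add_eq] at this

lemma cJP_mul_conj_eq {p : ℝ} (q : ℝ) (hp : -(1 / 2) < p) {ζ : ℂ} (hζ : ‖ζ‖ = 1) (n : ℕ) :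
    cJP p q n ζ * (starRingEnd ℂ) (cJP p q n ζ) = cJQ p q n ζ * (starRingEnd ℂ) (cJQ p q n ζ) := by
  have := norm_hyperPoly_eq (cJ_conj p q) (cJ_param_ne_zero q hp) hζ n
  rwa [cJ_add_eq] at this

lemma continuous_mul_node_zpow {f : ℂ → ℂ} (hf : Continuous f) (m : ℤ) :
    Continuous fun θ => f (cJNode θ) * cJNode θ ^ m :=
  (hf.comp continuous_cJNode).mul (continuous_cJNode_zpow m)

lemma cJMean_linear_comb {p : ℝ} (q : ℝ) (hp : -(1 / 2) < p) (k l : ℂ) {f g : ℝ → ℂ}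
    (hf : Continuous f) (hg : Continuous g) :
    cJMean p q (fun θ => k * f θ + l * g θ) = k * cJMean p q f + l * cJMean p q g := by
  rw [← cJMean_const_mul, ← cJMean_const_mul]
  exact cJMean_add q hp (continuous_const.mul hf) (continuous_const.mul hg)

/-- All moments of `P_n w` and `Q_n w` in closed form, by induction along the Szegő recursion.
The factor `(-m)_n` makes `P_n` orthogonal to `ζ^m` for `0 ≤ m < n`. -/
lemma cJMean_cJP_cJQ {p : ℝ} (q : ℝ) (hp : -(1 / 2) < p) (n : ℕ) : ∀ m : ℤ,
    cJMean p q (fun θ => cJP p q n (cJNode θ) * cJNode θ ^ (-m))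
      = (-1) ^ m * cJMomentConst p q * (∏ j ∈ Finset.range n, (-(m : ℂ) + j)) *
        (Complex.Gamma (p - Complex.I * q - m + 1 + n))⁻¹ *
        (Complex.Gamma (p + Complex.I * q + m + 1))⁻¹ ∧
    cJMean p q (fun θ => cJQ p q n (cJNode θ) * cJNode θ ^ (-m))
      = (-1) ^ m * cJMomentConst p q * (∏ j ∈ Finset.range n, (1 - (m : ℂ) + j)) *
        (Complex.Gamma (p - Complex.I * q - m + 1 + n))⁻¹ *
        (Complex.Gamma (p + Complex.I * q + m + 1))⁻¹ := by
  induction n with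
  | zero =>
    intro m
    have := cJMoment_eq q hp m
    simp only [cJP_zero, cJQ_zero, one_mul, Finset.range_zero, Finset.prod_empty, mul_one,
      Nat.cast_zero, add_zero]
    exact ⟨this, this⟩
  | succ n ih =>
    intro m
    have hn : (n + (2 * p + 1) : ℂ) ≠ 0 := by
      rw [add_comm]; exact cJ_two_p_add_ne_zero hp n
    have hcP := fun j => continuous_mul_node_zpow (continuous_cJP p q n) j
    have hcQ := fun j => continuous_mul_node_zpow (continuous_cJQ p q n) j
    have hP0 := (ih (m - 1)).1
    have hQ0 := (ih m).2
    have g1 := Complex.one_div_Gamma_eq_self_mul_one_div_Gamma_add_one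
      (p - Complex.I * q - m + 1 + n)
    have g2 := Complex.one_div_Gamma_eq_self_mul_one_div_Gamma_add_one
      (p + Complex.I * q + (m - 1 : ℤ) + 1)
    have a1 : (p - Complex.I * q - ((m - 1 : ℤ) : ℂ) + 1 + n)
      = p - Complex.I * q - m + 1 + n + 1 := by push_cast; ring
    have a2 : (p + Complex.I * q + ((m - 1 : ℤ) : ℂ) + 1 + 1)
      = p + Complex.I * q + m + 1 := by push_cast; ring
    have a3 : (p - Complex.I * q - m + 1 + ((n + 1 : ℕ) : ℂ))
      = p - Complex.I * q - m + 1 + n + 1 := by push_cast; ring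
    have a4 : ∀ j : ℕ, (-((m - 1 : ℤ) : ℂ) + j) = 1 - m + j := fun j => by push_cast; ring
    rw [a2] at g2
    rw [a1, g2] at hP0
    simp only [a4] at hP0
    rw [g1] at hQ0
    rw [zpow_sub_one₀ (by norm_num)] at hP0
    rw [a3]
    have shiftP : ∀ θ, cJNode θ * cJP p q n (cJNode θ) * cJNode θ ^ (-m)
        = cJP p q n (cJNode θ) * cJNode θ ^ (-(m - 1)) := by
      intro θ
      rw [show -(m - 1) = -m + 1 by ring, zpow_add_one₀ (cJNode_ne_zero θ)]; ring
    have pr : ∏ j ∈ Finset.range (n + 1), (-(m : ℂ) + j)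
        = -m * ∏ j ∈ Finset.range n, (1 - (m : ℂ) + j) := by
      rw [Finset.prod_range_succ']
      simp only [Nat.cast_zero, add_zero]
      rw [mul_comm]
      congr 1
      refine Finset.prod_congr rfl fun j _ => by push_cast; ring
    refine ⟨mul_left_cancel₀ hn ?_, mul_left_cancel₀ hn ?_⟩
    · rw [← cJMean_const_mul]
      have : (fun θ => (n + (2 * p + 1) : ℂ) * (cJP p q (n + 1) (cJNode θ) * cJNode θ ^ (-m)))
          = fun θ => (p + Complex.I * q) * (cJQ p q n (cJNode θ) * cJNode θ ^ (-m))
            + (n + 1 + (p - Complex.I * q)) *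
              (cJP p q n (cJNode θ) * cJNode θ ^ (-(m - 1))) := by
        ext θ
        rw [← mul_assoc, cJP_rec q hp, ← shiftP]; ring
      rw [this, cJMean_linear_comb q hp _ _ (hcQ _) (hcP _), hP0, hQ0, pr]
      push_cast
      ring
    · rw [← cJMean_const_mul]
      have : (fun θ => (n + (2 * p + 1) : ℂ) * (cJQ p q (n + 1) (cJNode θ) * cJNode θ ^ (-m)))
          = fun θ => (p - Complex.I * q) * (cJP p q n (cJNode θ) * cJNode θ ^ (-(m - 1)))
            + (n + 1 + (p + Complex.I * q)) * (cJQ p q n (cJNode θ) * cJNode θ ^ (-m)) := by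
        ext θ
        rw [← mul_assoc, cJQ_rec q hp, ← shiftP]; ring
      rw [this, cJMean_linear_comb q hp _ _ (hcP _) (hcQ _), hP0, hQ0, Finset.prod_range_succ]
      push_cast
      ring

/-- The polynomial in `ζ` underlying `cJP`. -/
noncomputable def cJPoly (p q : ℝ) (n : ℕ) : Polynomial ℂ :=
  ∑ k ∈ Finset.range (n + 1), Polynomial.C ((n.choose k : ℂ) *
    pochRatio (p - Complex.I * q + 1) (2 * p + 1) k) * (Polynomial.X - Polynomial.C 1) ^ k

lemma eval_cJPoly (p q : ℝ) (n : ℕ) (ζ : ℂ) : (cJPoly p q n).eval ζ = cJP p q n ζ := by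
  simp [cJPoly, cJP, hyperPoly, Polynomial.eval_finsetSum]

lemma natDegree_cJPoly_le (p q : ℝ) (n : ℕ) : (cJPoly p q n).natDegree ≤ n := by
  refine Polynomial.natDegree_sum_le_of_forall_le _ _ fun k hk => ?_
  refine (Polynomial.natDegree_C_mul_le _ _).trans ?_
  rw [Polynomial.natDegree_pow, Polynomial.natDegree_X_sub_C, mul_one]
  exact Nat.lt_succ_iff.1 (Finset.mem_range.1 hk)

lemma coeff_cJPoly (p q : ℝ) (n : ℕ) :
    (cJPoly p q n).coeff n = pochRatio (p - Complex.I * q + 1) (2 * p + 1) n := by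
  rw [cJPoly, Polynomial.finsetSum_coeff, Finset.sum_range_succ, Finset.sum_eq_zero, zero_add,
    Polynomial.coeff_C_mul]
  · have h := (Polynomial.monic_X_sub_C (1 : ℂ)).pow n
    have hd : ((Polynomial.X - Polynomial.C (1 : ℂ)) ^ n).natDegree = n := by
      rw [Polynomial.natDegree_pow, Polynomial.natDegree_X_sub_C, mul_one]
    rw [Polynomial.Monic, Polynomial.leadingCoeff, hd] at h
    rw [h]; simp
  · intro k hk
    rw [Polynomial.coeff_C_mul, Polynomial.coeff_eq_zero_of_natDegree_lt, mul_zero]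
    rw [Polynomial.natDegree_pow, Polynomial.natDegree_X_sub_C, mul_one]
    exact Finset.mem_range.1 hk

/-- `d_n = (2p+1)_n / n!`; the squared norm of `P_n` is `c₀ / d_n`. -/
noncomputable def cJNormInv (p : ℝ) (n : ℕ) : ℝ := ∏ j ∈ Finset.range n, (2 * p + 1 + j) / (j + 1)

lemma cJNormInv_succ (p : ℝ) (n : ℕ) :
    cJNormInv p (n + 1) = cJNormInv p n * ((2 * p + 1 + n) / (n + 1)) :=
  Finset.prod_range_succ _ _

lemma cJNormInv_pos {p : ℝ} (hp : -(1 / 2) < p) (n : ℕ) : 0 < cJNormInv p n := by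
  refine Finset.prod_pos fun j _ => ?_
  have : (0 : ℝ) ≤ j := j.cast_nonneg
  exact div_pos (by linarith) (by linarith)

lemma conj_cJP (p q : ℝ) (n : ℕ) (θ : ℝ) :
    (starRingEnd ℂ) (cJP p q n (cJNode θ)) = ∑ m ∈ Finset.range (n + 1),
      (starRingEnd ℂ) ((cJPoly p q n).coeff m) * cJNode θ ^ (-(m : ℤ)) := by
  rw [← eval_cJPoly, Polynomial.eval_eq_sum_range' (Nat.lt_succ_of_le (natDegree_cJPoly_le p q n)),
    map_sum]
  refine Finset.sum_congr rfl fun m _ => ?_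
  rw [map_mul, map_pow, conj_cJNode, zpow_neg, zpow_natCast, inv_pow]

lemma cJMean_cJP_mul_conj {p : ℝ} (q : ℝ) (hp : -(1 / 2) < p) (n l : ℕ) :
    cJMean p q (fun θ => cJP p q n (cJNode θ) * (starRingEnd ℂ) (cJP p q l (cJNode θ)))
      = ∑ m ∈ Finset.range (l + 1), (starRingEnd ℂ) ((cJPoly p q l).coeff m) *
        cJMean p q (fun θ => cJP p q n (cJNode θ) * cJNode θ ^ (-(m : ℤ))) := by
  simp only [conj_cJP, Finset.mul_sum]
  rw [cJMean_sum q hp]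
  · refine Finset.sum_congr rfl fun m _ => ?_
    rw [← cJMean_const_mul]
    congr 1; ext θ; ring
  · intro m _
    have h1 : Continuous fun θ => cJP p q n (cJNode θ) := by fun_prop
    exact h1.mul (continuous_const.mul (continuous_cJNode_zpow _))

lemma cJMean_cJP_mul_zpow_eq_zero {p : ℝ} (q : ℝ) (hp : -(1 / 2) < p) {n m : ℕ} (h : m < n) :
    cJMean p q (fun θ => cJP p q n (cJNode θ) * cJNode θ ^ (-(m : ℤ))) = 0 := by
  rw [(cJMean_cJP_cJQ q hp n m).1, Finset.prod_eq_zero (Finset.mem_range.2 h) (by simp)]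
  simp

lemma cJMean_cJP_orthogonal {p : ℝ} (q : ℝ) (hp : -(1 / 2) < p) {n l : ℕ} (h : n ≠ l) :
    cJMean p q (fun θ => cJP p q n (cJNode θ) * (starRingEnd ℂ) (cJP p q l (cJNode θ))) = 0 := by
  have key : ∀ {n l : ℕ}, l < n → cJMean p q
      (fun θ => cJP p q n (cJNode θ) * (starRingEnd ℂ) (cJP p q l (cJNode θ))) = 0 := by
    intro n l hl
    rw [cJMean_cJP_mul_conj q hp]
    refine Finset.sum_eq_zero fun m hm => ?_
    rw [cJMean_cJP_mul_zpow_eq_zero q hp (by have := Finset.mem_range.1 hm; omega), mul_zero]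
  rcases lt_or_gt_of_ne h with h | h
  · have := cJMean_conj p q
      (fun θ => cJP p q l (cJNode θ) * (starRingEnd ℂ) (cJP p q n (cJNode θ)))
    rw [key h, map_zero] at this
    rw [← this]
    congr 1; ext θ
    simp [mul_comm]
  · exact key h

/-- The pairing `∫ P_n ζ^{-n} w` is `c₀ n! / (b + 1)_n` with `b = p + i q`. -/
lemma cJMean_cJP_mul_zpow_self {p : ℝ} (q : ℝ) (hp : -(1 / 2) < p) (n : ℕ) :
    (∏ j ∈ Finset.range n, (p + Complex.I * q + 1 + j)) *
      cJMean p q (fun θ => cJP p q n (cJNode θ) * cJNode θ ^ (-(n : ℤ)))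
      = n.factorial * cJMass p q := by
  have hg1 : Complex.Gamma (p - Complex.I * q + 1) ≠ 0 :=
    Complex.Gamma_ne_zero_of_re_pos (by simp; linarith)
  have hg2 : Complex.Gamma (p + Complex.I * q + 1) ≠ 0 :=
    Complex.Gamma_ne_zero_of_re_pos (by simp; linarith)
  have hG : ∀ n : ℕ, (∏ j ∈ Finset.range n, (p + Complex.I * q + 1 + j)) *
      (Complex.Gamma (p + Complex.I * q + n + 1))⁻¹
      = (Complex.Gamma (p + Complex.I * q + 1))⁻¹ := by
    intro n
    induction n with
    | zero => simp
    | succ n ih =>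
      rw [← ih, Finset.prod_range_succ]
      have := Complex.one_div_Gamma_eq_self_mul_one_div_Gamma_add_one (p + Complex.I * q + n + 1)
      rw [this]
      push_cast
      ring_nf
  have hF : ∀ n : ℕ, ((-1 : ℂ)) ^ n * ∏ j ∈ Finset.range n, (-(n : ℂ) + j) = n.factorial := by
    intro n
    have hs : (-1 : ℂ) ^ n = ∏ _j ∈ Finset.range n, (-1 : ℂ) := by simp
    rw [← Finset.prod_range_reflect, ← Finset.prod_range_add_one_eq_factorial, hs,
      ← Finset.prod_mul_distrib]
    push_cast
    refine Finset.prod_congr rfl fun j hj => ?_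
    have hj := Finset.mem_range.1 hj
    rw [Nat.cast_sub (by omega), Nat.cast_sub (by omega)]
    push_cast; ring
  rw [(cJMean_cJP_cJQ q hp n n).1, zpow_natCast]
  have h1 : (p - Complex.I * q - ((n : ℤ) : ℂ) + 1 + n) = p - Complex.I * q + 1 := by
    push_cast; ring
  rw [h1]
  push_cast
  calc _ = (((-1 : ℂ)) ^ n * ∏ j ∈ Finset.range n, (-(n : ℂ) + j)) * cJMomentConst p q *
        (Complex.Gamma (p - Complex.I * q + 1))⁻¹ *
        ((∏ j ∈ Finset.range n, (p + Complex.I * q + 1 + j)) *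
          (Complex.Gamma (p + Complex.I * q + n + 1))⁻¹) := by ring
    _ = _ := by
      rw [hF, hG, cJMomentConst]
      field_simp

/-- The squared norm of `P_n`. Only the leading coefficient of `conj P_n` contributes, and its
numerator `(b + 1)_n` cancels against the pairing with `ζ^n`. -/
lemma cJMean_cJP_norm {p : ℝ} (q : ℝ) (hp : -(1 / 2) < p) (n : ℕ) :
    cJMean p q (fun θ => cJP p q n (cJNode θ) * (starRingEnd ℂ) (cJP p q n (cJNode θ)))
      = ((cJMass p q / cJNormInv p n : ℝ) : ℂ) := by
  rw [cJMean_cJP_mul_conj q hp, Finset.sum_range_succ, Finset.sum_eq_zero, zero_add, coeff_cJPoly]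
  · have h := cJMean_cJP_mul_zpow_self q hp n
    have e1 : (starRingEnd ℂ) (pochRatio (p - Complex.I * q + 1) (2 * p + 1) n)
        = (∏ j ∈ Finset.range n, (p + Complex.I * q + 1 + j)) /
          ∏ j ∈ Finset.range n, (2 * p + 1 + j : ℂ) := by
      rw [pochRatio, Finset.prod_div_distrib, map_div₀, map_prod, map_prod]
      congr 1 <;> refine Finset.prod_congr rfl fun j _ => by simp [Complex.conj_ofNat]
    have e2 : ((cJNormInv p n : ℝ) : ℂ)
        = (∏ j ∈ Finset.range n, (2 * p + 1 + j : ℂ)) / n.factorial := by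
      rw [cJNormInv, Finset.prod_div_distrib, ← Finset.prod_range_add_one_eq_factorial]
      push_cast
      rfl
    have hne : (∏ j ∈ Finset.range n, (2 * p + 1 + j : ℂ)) ≠ 0 :=
      Finset.prod_ne_zero_iff.2 fun j _ => cJ_two_p_add_ne_zero hp j
    have hf : (n.factorial : ℂ) ≠ 0 := by exact_mod_cast n.factorial_ne_zero
    push_cast
    rw [e1, e2, div_mul_eq_mul_div, h]
    field_simp
  · intro m hm
    rw [cJMean_cJP_mul_zpow_eq_zero q hp (Finset.mem_range.1 hm), mul_zero]

/-! ### Andréief's identity and the one-point density -/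

/-- The matrix of values `f_i(x_j)`; rows are indexed by functions, columns by points. -/
def evalMatrix {α : Type*} {n : ℕ} (f : Fin n → α → ℂ) (x : Fin n → α) : Matrix (Fin n) (Fin n) ℂ :=
  Matrix.of fun i j => f i (x j)

/-- The matrix of pairings `∫ f_i g_j`. -/
noncomputable def pairingMatrix {α : Type*} [MeasurableSpace α] {n : ℕ} (μ : Measure α)
    (f g : Fin n → α → ℂ) :
    Matrix (Fin n) (Fin n) ℂ :=
  Matrix.of fun i j => ∫ x, f i x * g j x ∂μ

lemma det_mul_det_evalMatrix {α : Type*} {n : ℕ} (f g : Fin n → α → ℂ) (x : Fin n → α) :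
    (evalMatrix f x).det * (evalMatrix g x).det
      = ∑ σ : Equiv.Perm (Fin n), ∑ τ : Equiv.Perm (Fin n),
        ((Equiv.Perm.sign σ : ℤ) : ℂ) * ((Equiv.Perm.sign τ : ℤ) : ℂ) *
          ∏ j, f (σ j) (x j) * g (τ j) (x j) := by
  rw [Matrix.det_apply', Matrix.det_apply', Finset.sum_mul_sum]
  refine Finset.sum_congr rfl fun σ _ => Finset.sum_congr rfl fun τ _ => ?_
  simp only [evalMatrix, Matrix.of_apply, Finset.prod_mul_distrib]
  ring

lemma integrable_det_mul_det {α : Type*} [MeasurableSpace α] {μ : Measure α}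
    [SigmaFinite μ] {n : ℕ} {f g : Fin n → α → ℂ}
    (h : ∀ i j, Integrable (fun x => f i x * g j x) μ) :
    Integrable (fun x => (evalMatrix f x).det * (evalMatrix g x).det)
      (Measure.pi fun _ : Fin n => μ) := by
  simp only [det_mul_det_evalMatrix]
  refine integrable_finsetSum _ fun σ _ => integrable_finsetSum _ fun τ _ => ?_
  exact (Integrable.fintype_prod (f := fun j x => f (σ j) x * g (τ j) x)
    fun j => h _ _).const_mul _

/-- Andréief's identity. -/
lemma integral_det_mul_det {α : Type*} [MeasurableSpace α] {μ : Measure α}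
    [SigmaFinite μ] {n : ℕ} {f g : Fin n → α → ℂ}
    (h : ∀ i j, Integrable (fun x => f i x * g j x) μ) :
    ∫ x, (evalMatrix f x).det * (evalMatrix g x).det ∂(Measure.pi fun _ : Fin n => μ)
      = n.factorial * (pairingMatrix μ f g).det := by
  simp only [det_mul_det_evalMatrix]
  have hi : ∀ σ τ : Equiv.Perm (Fin n), Integrable (fun x : Fin n → α =>
      ((Equiv.Perm.sign σ : ℤ) : ℂ) * ((Equiv.Perm.sign τ : ℤ) : ℂ) *
        ∏ j, f (σ j) (x j) * g (τ j) (x j)) (Measure.pi fun _ : Fin n => μ) := fun σ τ =>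
    (Integrable.fintype_prod (f := fun j x => f (σ j) x * g (τ j) x) fun j => h _ _).const_mul _
  rw [integral_finsetSum _ fun σ _ => integrable_finsetSum _ fun τ _ => hi σ τ]
  have hσ : ∀ σ : Equiv.Perm (Fin n), ∫ x : Fin n → α, ∑ τ : Equiv.Perm (Fin n),
      ((Equiv.Perm.sign σ : ℤ) : ℂ) * ((Equiv.Perm.sign τ : ℤ) : ℂ) *
        ∏ j, f (σ j) (x j) * g (τ j) (x j) ∂(Measure.pi fun _ : Fin n => μ)
      = (pairingMatrix μ f g).det := by
    intro σ
    rw [integral_finsetSum _ fun τ _ => hi σ τ]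
    have hτ : ∀ τ : Equiv.Perm (Fin n), ∫ x : Fin n → α,
        ((Equiv.Perm.sign σ : ℤ) : ℂ) * ((Equiv.Perm.sign τ : ℤ) : ℂ) *
          ∏ j, f (σ j) (x j) * g (τ j) (x j) ∂(Measure.pi fun _ : Fin n => μ)
        = ((Equiv.Perm.sign σ : ℤ) : ℂ) * (((Equiv.Perm.sign τ : ℤ) : ℂ) *
          ∏ j, ((pairingMatrix μ f g).transpose.submatrix id σ) (τ j) j) := by
      intro τ
      rw [integral_const_mul, mul_assoc,
        integral_fintype_prod_eq_prod (fun j x => f (σ j) x * g (τ j) x)]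
      rfl
    simp only [hτ]
    rw [← Finset.mul_sum, ← Matrix.det_apply', Matrix.det_permute', Matrix.det_transpose,
      ← mul_assoc]
    have : ((Equiv.Perm.sign σ : ℤ) : ℂ) * ((Equiv.Perm.sign σ : ℤ) : ℂ) = 1 := by
      rw [← Int.cast_mul, ← Units.val_mul, Int.units_mul_self]; simp
    rw [this, one_mul]
  simp only [hσ]
  rw [Finset.sum_const, Finset.card_univ, Fintype.card_perm, Fintype.card_fin, nsmul_eq_mul]

lemma det_pairingMatrix_of_biorthogonal {α : Type*} [MeasurableSpace α] {μ : Measure α}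
    {n : ℕ} {f g : Fin n → α → ℂ} {h : Fin n → ℂ}
    (horth : ∀ i j, i ≠ j → ∫ x, f i x * g j x ∂μ = 0) (hnorm : ∀ i, ∫ x, f i x * g i x ∂μ = h i) :
    (pairingMatrix μ f g).det = ∏ i, h i := by
  have : pairingMatrix μ f g = Matrix.diagonal h := by
    ext i j
    rcases eq_or_ne i j with rfl | hij
    · simp [pairingMatrix, hnorm]
    · rw [Matrix.diagonal_apply_ne _ hij]
      exact horth i j hij
  rw [this, Matrix.det_diagonal]

/-- Integrating out all but one variable of a product of two determinants leaves the diagonal of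
the Christoffel–Darboux kernel: after expanding along the column of the fixed point only the
diagonal terms survive biorthogonality. -/
lemma integral_det_mul_det_cons {α : Type*} [MeasurableSpace α] {μ : Measure α}
    [SigmaFinite μ] {n : ℕ} {f g : Fin (n + 1) → α → ℂ} {h : Fin (n + 1) → ℂ}
    (hint : ∀ i j, Integrable (fun x => f i x * g j x) μ)
    (horth : ∀ i j, i ≠ j → ∫ x, f i x * g j x ∂μ = 0)
    (hnorm : ∀ i, ∫ x, f i x * g i x ∂μ = h i) (h0 : ∀ i, h i ≠ 0) (t : α) :
    ∫ φ, (evalMatrix f (Fin.cons t φ : Fin (n + 1) → α)).det *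
        (evalMatrix g (Fin.cons t φ : Fin (n + 1) → α)).det ∂(Measure.pi fun _ : Fin n => μ)
      = n.factorial * (∏ i, h i) * ∑ i, f i t * g i t / h i := by
  have hexp : ∀ (f : Fin (n + 1) → α → ℂ) (φ : Fin n → α),
      (evalMatrix f (Fin.cons t φ : Fin (n + 1) → α)).det
        = ∑ i : Fin (n + 1), (-1) ^ (i : ℕ) * f i t *
          (evalMatrix (fun r => f (i.succAbove r)) φ).det := by
    intro f φ
    rw [Matrix.det_succ_column_zero]
    rfl
  have hI : ∀ i k : Fin (n + 1), Integrable (fun φ : Fin n → α =>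
      (evalMatrix (fun r => f (i.succAbove r)) φ).det *
        (evalMatrix (fun r => g (k.succAbove r)) φ).det) (Measure.pi fun _ : Fin n => μ) :=
    fun i k => integrable_det_mul_det fun _ _ => hint _ _
  have hsum : ∀ φ : Fin n → α, (evalMatrix f (Fin.cons t φ : Fin (n + 1) → α)).det *
        (evalMatrix g (Fin.cons t φ : Fin (n + 1) → α)).det
      = ∑ i : Fin (n + 1), ∑ k : Fin (n + 1),
        ((-1) ^ (i : ℕ) * f i t * ((-1) ^ (k : ℕ) * g k t)) *
        ((evalMatrix (fun r => f (i.succAbove r)) φ).det *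
        (evalMatrix (fun r => g (k.succAbove r)) φ).det) := by
    intro φ
    rw [hexp f, hexp g, Finset.sum_mul_sum]
    refine Finset.sum_congr rfl fun i _ => Finset.sum_congr rfl fun k _ => by ring
  simp only [hsum]
  rw [integral_finsetSum _ fun i _ => integrable_finsetSum _ fun k _ => (hI i k).const_mul _]
  simp only [integral_finsetSum _ fun k _ => (hI _ k).const_mul _, integral_const_mul]
  have hoff : ∀ i k : Fin (n + 1), i ≠ k →
      ∫ φ, (evalMatrix (fun r => f (i.succAbove r)) φ).det *
        (evalMatrix (fun r => g (k.succAbove r)) φ).det ∂(Measure.pi fun _ : Fin n => μ) = 0 := by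
    intro i k hik
    rw [integral_det_mul_det fun _ _ => hint _ _]
    obtain ⟨r, hr⟩ := Fin.exists_succAbove_eq hik.symm
    rw [Matrix.det_eq_zero_of_row_eq_zero r, mul_zero]
    intro j
    refine horth _ _ ?_
    rw [hr]
    exact (Fin.succAbove_ne k j).symm
  have hdiag : ∀ i : Fin (n + 1),
      ∫ φ, (evalMatrix (fun r => f (i.succAbove r)) φ).det *
        (evalMatrix (fun r => g (i.succAbove r)) φ).det ∂(Measure.pi fun _ : Fin n => μ)
      = n.factorial * ∏ r, h (i.succAbove r) := by
    intro i
    rw [integral_det_mul_det fun _ _ => hint _ _, det_pairingMatrix_of_biorthogonal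
      (h := fun r => h (i.succAbove r)) (fun r s hrs => horth _ _ fun e =>
        hrs (Fin.succAbove_right_injective e)) (fun r => hnorm _)]
  rw [Finset.mul_sum]
  refine Finset.sum_congr rfl fun i _ => ?_
  rw [Finset.sum_eq_single i]
  · rw [hdiag, Fin.prod_univ_succAbove h i]
    have hs : ((-1 : ℂ)) ^ (i : ℕ) * (-1) ^ (i : ℕ) = 1 := by rw [← mul_pow]; norm_num
    have := h0 i
    field_simp
    linear_combination f i t * g i t * n.factorial * (∏ r, h (i.succAbove r)) * hs
  · intro k _ hk
    rw [hoff i k hk.symm, mul_zero]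
  · simp

/-- The functions `P_i(ζ(θ))`. -/
noncomputable def cJFun (p q : ℝ) (i : ℕ) (θ : ℝ) : ℂ := cJP p q i (cJNode θ)

/-- The dual functions `w(θ) conj (P_i(ζ(θ)))`. -/
noncomputable def cJDual (p q : ℝ) (i : ℕ) (θ : ℝ) : ℂ :=
  (cJWeight 2 p q θ : ℂ) * (starRingEnd ℂ) (cJP p q i (cJNode θ))

lemma integral_cJFun_mul_cJDual (p q : ℝ) (i j : ℕ) :
    ∫ θ, cJFun p q i θ * cJDual p q j θ ∂cJArc
      = cJMean p q (fun θ => cJP p q i (cJNode θ) * (starRingEnd ℂ) (cJP p q j (cJNode θ))) := by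
  simp only [cJMean, cJFun, cJDual]
  congr 1; ext θ; ring

lemma integrable_cJFun_mul_cJDual {p : ℝ} (q : ℝ) (hp : -(1 / 2) < p) (i j : ℕ) :
    Integrable (fun θ => cJFun p q i θ * cJDual p q j θ) cJArc := by
  have hc : Continuous fun θ =>
      cJP p q i (cJNode θ) * (starRingEnd ℂ) (cJP p q j (cJNode θ)) := by
    have h1 : ∀ i, Continuous fun θ => cJP p q i (cJNode θ) := fun i => by fun_prop
    exact (h1 i).mul (Complex.continuous_conj.comp (h1 j))
  refine (integrable_cJWeight_mul q hp hc).congr (ae_of_all _ fun θ => ?_)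
  simp only [cJFun, cJDual]; ring

/-- The product of the leading coefficients of `P_0, …, P_{N-1}`. -/
noncomputable def cJLead (p q : ℝ) (N : ℕ) : ℂ :=
  ∏ i : Fin N, pochRatio (p - Complex.I * q + 1) (2 * p + 1) i

lemma cJLead_ne_zero {p : ℝ} (q : ℝ) (hp : -(1 / 2) < p) (N : ℕ) : cJLead p q N ≠ 0 := by
  refine Finset.prod_ne_zero_iff.2 fun i _ => Finset.prod_ne_zero_iff.2 fun j _ => ?_
  refine div_ne_zero (fun h0 => ?_) (cJ_two_p_add_ne_zero hp j)
  have := congrArg Complex.re h0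
  simp at this
  have hi : (0 : ℝ) ≤ j := j.cast_nonneg
  linarith

/-- The determinant of the orthogonal polynomials is the Vandermonde determinant up to the
leading coefficients. -/
lemma det_evalMatrix_cJFun (p q : ℝ) (N : ℕ) (θ : Fin N → ℝ) :
    (evalMatrix (fun i : Fin N => cJFun p q i) θ).det
      = (Matrix.vandermonde fun j => cJNode (θ j)).det * cJLead p q N := by
  have h1 := Matrix.eval_matrixOfPolynomials_eq_vandermonde_mul_matrixOfPolynomials
    (fun j => cJNode (θ j)) (fun i : Fin N => cJPoly p q i) fun i => natDegree_cJPoly_le p q i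
  have h2 : (evalMatrix (fun i : Fin N => cJFun p q i) θ).transpose
      = Matrix.of fun i j : Fin N => ((cJPoly p q j).eval (cJNode (θ i))) := by
    ext i j
    simp [evalMatrix, cJFun, eval_cJPoly]
  rw [← Matrix.det_transpose, h2, h1, Matrix.det_mul, Matrix.det_of_isUpperTriangular
    (M := Matrix.of fun i j : Fin N => (cJPoly p q j).coeff i)]
  · simp only [Matrix.of_apply, coeff_cJPoly]; rfl
  · intro i j hij
    exact Polynomial.coeff_eq_zero_of_natDegree_lt
      ((natDegree_cJPoly_le p q j).trans_lt hij)

lemma det_evalMatrix_cJDual (p q : ℝ) (N : ℕ) (θ : Fin N → ℝ) :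
    (evalMatrix (fun i : Fin N => cJDual p q i) θ).det
      = (∏ l, (cJWeight 2 p q (θ l) : ℂ)) *
        (starRingEnd ℂ) (evalMatrix (fun i : Fin N => cJFun p q i) θ).det := by
  have : evalMatrix (fun i : Fin N => cJDual p q i) θ
      = Matrix.of fun i j => (cJWeight 2 p q (θ j) : ℂ) *
        ((evalMatrix (fun i : Fin N => cJFun p q i) θ).map (starRingEnd ℂ)) i j := by
    ext i j; rfl
  rw [this, Matrix.det_mul_row]
  congr 1
  rw [RingHom.map_det]
  rfl

lemma cJUnnormalised_eq_det (p q : ℝ) (N : ℕ) (θ : Fin N → ℝ) :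
    (cJUnnormalised 2 p q N θ : ℂ) * (cJLead p q N * (starRingEnd ℂ) (cJLead p q N))
      = (evalMatrix (fun i : Fin N => cJFun p q i) θ).det *
        (evalMatrix (fun i : Fin N => cJDual p q i) θ).det := by
  rw [det_evalMatrix_cJDual, det_evalMatrix_cJFun, map_mul, Matrix.det_vandermonde]
  have hv : ((∏ j, ∏ k ∈ Finset.Ioi j,
      ‖Complex.exp (Complex.I * θ k) - Complex.exp (Complex.I * θ j)‖ ^ (2 : ℝ) : ℝ) : ℂ)
      = (∏ i, ∏ j ∈ Finset.Ioi i, (cJNode (θ j) - cJNode (θ i))) *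
        (starRingEnd ℂ) (∏ i, ∏ j ∈ Finset.Ioi i, (cJNode (θ j) - cJNode (θ i))) := by
    rw [Complex.mul_conj, map_prod]
    congr 1
    refine Finset.prod_congr rfl fun i _ => ?_
    rw [map_prod]
    refine Finset.prod_congr rfl fun j _ => ?_
    rw [Complex.normSq_eq_norm_sq, Real.rpow_two, cJNode, cJNode, ← neg_sub', norm_neg]
  rw [cJUnnormalised, Complex.ofReal_mul, hv]
  push_cast
  ring

lemma volume_restrict_angleBox (n : ℕ) :
    (volume : Measure (Fin n → ℝ)).restrict (angleBox n) = Measure.pi fun _ => cJArc := by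
  rw [volume_pi, angleBox, Measure.restrict_pi_pi]
  rfl

/-- The one-point density of the finite ensemble is the weighted Christoffel–Darboux kernel on
the diagonal. -/
lemma cJDensity_eq {p : ℝ} (q : ℝ) (hp : -(1 / 2) < p) (N : ℕ) (t : ℝ) :
    (cJDensity 2 p q N t : ℂ) = (cJWeight 2 p q t / cJMass p q : ℝ) *
      ∑ k ∈ Finset.range N, (cJNormInv p k : ℂ) *
        (cJP p q k (cJNode t) * (starRingEnd ℂ) (cJP p q k (cJNode t))) := by
  cases N with
  | zero => simp [cJDensity]
  | succ n =>
    have hM := (cJMass_pos q hp).ne'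
    have hd := fun i => (cJNormInv_pos hp i).ne'
    set L : ℂ := cJLead p q (n + 1) * (starRingEnd ℂ) (cJLead p q (n + 1)) with hL
    have hL0 : L ≠ 0 := mul_ne_zero (cJLead_ne_zero q hp _)
      ((map_ne_zero _).2 (cJLead_ne_zero q hp _))
    set h : Fin (n + 1) → ℂ := fun i => ((cJMass p q / cJNormInv p i : ℝ) : ℂ) with hh
    have hh0 : ∀ i, h i ≠ 0 := fun i => by
      simp only [hh]
      exact_mod_cast div_ne_zero hM (hd i)
    have hint : ∀ i j : Fin (n + 1), Integrable (fun x => cJFun p q i x * cJDual p q j x) cJArc :=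
      fun i j => integrable_cJFun_mul_cJDual q hp i j
    have horth : ∀ i j : Fin (n + 1), i ≠ j →
        ∫ x, cJFun p q i x * cJDual p q j x ∂cJArc = 0 := fun i j hij => by
      rw [integral_cJFun_mul_cJDual, cJMean_cJP_orthogonal q hp (Fin.val_ne_of_ne hij)]
    have hnorm : ∀ i : Fin (n + 1), ∫ x, cJFun p q i x * cJDual p q i x ∂cJArc = h i := fun i => by
      rw [integral_cJFun_mul_cJDual, cJMean_cJP_norm q hp]
    have hun : ∀ θ : Fin (n + 1) → ℝ, (cJUnnormalised 2 p q (n + 1) θ : ℂ)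
        = L⁻¹ * ((evalMatrix (fun i : Fin (n + 1) => cJFun p q i) θ).det *
        (evalMatrix (fun i : Fin (n + 1) => cJDual p q i) θ).det) := fun θ => by
      rw [← cJUnnormalised_eq_det, ← hL]; field_simp
    have hZ : (cJPartition 2 p q (n + 1) : ℂ) = L⁻¹ * ((n + 1).factorial * ∏ i, h i) := by
      rw [cJPartition, ← integral_complex_ofReal, volume_restrict_angleBox]
      simp only [hun]
      rw [integral_const_mul, integral_det_mul_det hint,
        det_pairingMatrix_of_biorthogonal horth hnorm]
    have hone : ((∫ φ in angleBox n, cJUnnormalised 2 p q (n + 1) (Fin.cons t φ) : ℝ) : ℂ)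
        = L⁻¹ * (n.factorial * (∏ i, h i) *
          ∑ i : Fin (n + 1), cJFun p q i t * cJDual p q i t / h i) := by
      rw [← integral_complex_ofReal, volume_restrict_angleBox]
      simp only [hun]
      rw [integral_const_mul, integral_det_mul_det_cons hint horth hnorm hh0]
    have hprod : ∏ i, h i ≠ 0 := Finset.prod_ne_zero_iff.2 fun i _ => hh0 i
    have hf : (n.factorial : ℂ) ≠ 0 := by exact_mod_cast n.factorial_ne_zero
    have hn1 : ((n : ℂ) + 1) ≠ 0 := by exact_mod_cast n.succ_ne_zero
    -- The constants `|leading coefficients|²` and `n!` cancel between numerator and partition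
    -- function.
    have hden : (cJDensity 2 p q (n + 1) t : ℂ)
        = ∑ i : Fin (n + 1), cJFun p q i t * cJDual p q i t / h i := by
      simp only [cJDensity, cJPDF]
      rw [integral_div]
      push_cast
      rw [hone, hZ, Nat.factorial_succ]
      push_cast
      field_simp
    rw [hden, Finset.sum_range, Finset.mul_sum]
    refine Finset.sum_congr rfl fun i _ => ?_
    have := hd i
    simp only [hh, cJFun, cJDual]
    have hMc : (cJMass p q : ℂ) ≠ 0 := by exact_mod_cast hM
    have hdc : (cJNormInv p i : ℂ) ≠ 0 := by exact_mod_cast hd i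
    push_cast
    field_simp

/-! ### The Christoffel–Darboux kernel on the diagonal -/

/-- Summation formula for the Christoffel–Darboux kernel on the diagonal, for `|ζ| = 1`. It plays
the role of the derivative form of the Christoffel–Darboux formula, but involves no derivative:
the derivative of `P_n` has been eliminated by its differential–difference equation. -/
lemma cJ_christoffelDarboux {p : ℝ} (q : ℝ) (hp : -(1 / 2) < p) {ζ : ℂ} (hζ : ‖ζ‖ = 1) (n : ℕ) :
    (1 - ζ) * ∑ k ∈ Finset.range n, (cJNormInv p k : ℂ) *
        (cJP p q k ζ * (starRingEnd ℂ) (cJP p q k ζ))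
      = cJNormInv p n *
        ((n * (1 - ζ) + (p + Complex.I * q) - (p - Complex.I * q) * ζ) *
            (cJP p q n ζ * (starRingEnd ℂ) (cJP p q n ζ))
          + (p - Complex.I * q) * ζ * (cJP p q n ζ * (starRingEnd ℂ) (cJQ p q n ζ))
          - (p + Complex.I * q) * ((starRingEnd ℂ) (cJP p q n ζ) * cJQ p q n ζ)) := by
  induction n with
  | zero =>
    simp [cJP_zero, cJQ_zero]
  | succ n ih =>
    have hzz : ζ * (starRingEnd ℂ) ζ = 1 := by
      rw [Complex.mul_conj, Complex.normSq_eq_norm_sq, hζ]; simp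
    have r1 := cJP_rec q hp n ζ
    have r2 := cJQ_rec q hp n ζ
    have s1 := congrArg (starRingEnd ℂ) r1
    have s2 := congrArg (starRingEnd ℂ) r2
    simp only [map_add, map_sub, map_mul, map_natCast, map_one, Complex.conj_ofReal,
      Complex.conj_I, Complex.conj_ofNat] at s1 s2
    have hn : (n + (2 * p + 1) : ℂ) ≠ 0 := by
      rw [add_comm]; exact cJ_two_p_add_ne_zero hp n
    have hn1 : ((n : ℂ) + 1) ≠ 0 := by exact_mod_cast n.succ_ne_zero
    have hd : (cJNormInv p (n + 1) : ℂ) * (n + 1) = cJNormInv p n * (n + (2 * p + 1)) := by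
      rw [cJNormInv_succ]
      push_cast
      field_simp
      ring
    rw [Finset.sum_range_succ, mul_add, ih]
    have hn2 : ((n + 1) * (n + (2 * p + 1)) : ℂ) ≠ 0 := mul_ne_zero hn1 hn
    refine mul_left_cancel₀ hn2 ?_
    generalize (starRingEnd ℂ) (cJP p q n ζ) = P' at *
    generalize (starRingEnd ℂ) (cJQ p q n ζ) = Q' at *
    generalize (starRingEnd ℂ) (cJP p q (n + 1) ζ) = P1' at *
    generalize (starRingEnd ℂ) (cJQ p q (n + 1) ζ) = Q1' at *
    generalize cJP p q n ζ = P at *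
    generalize cJQ p q n ζ = Q at *
    generalize cJP p q (n + 1) ζ = P1 at *
    generalize cJQ p q (n + 1) ζ = Q1 at *
    generalize (starRingEnd ℂ) ζ = ζ' at *
    generalize (cJNormInv p (n + 1) : ℂ) = D1 at *
    generalize (cJNormInv p n : ℂ) = D at *
    obtain ⟨a, ha⟩ : ∃ a : ℂ, a = p - Complex.I * q := ⟨_, rfl⟩
    obtain ⟨b, hb⟩ : ∃ b : ℂ, b = p + Complex.I * q := ⟨_, rfl⟩
    have hs : (n + (2 * p + 1) : ℂ) = n + 1 + a + b := by rw [ha, hb]; ring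
    have e1 : (p - -Complex.I * q : ℂ) = b := by rw [hb]; ring
    have e2 : (p + -Complex.I * q : ℂ) = a := by rw [ha]; ring
    rw [e1, e2] at s1 s2
    rw [hs] at r1 r2 s1 s2 hd
    rw [← ha] at r1 r2
    rw [← hb] at r1 r2
    rw [← ha, ← hb, hs]
    push_cast
    have key : (n + 1 + a + b) ^ 2 * (((n + 1) * (1 - ζ) + b - a * ζ) * (P1 * P1')
        + a * ζ * (P1 * Q1') - b * (P1' * Q1))
        = (n + 1) * (n + 1 + a + b) * ((n * (1 - ζ) + b - a * ζ) * (P * P')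
        + a * ζ * (P * Q') - b * (P' * Q) + (1 - ζ) * (P * P')) := by
      have t1 := congrArg₂ (· * ·) r1 s1
      have t2 := congrArg₂ (· * ·) r1 s2
      have t3 := congrArg₂ (· * ·) r2 s1
      -- The conjugated recursions are affine in `ζ' = ζ⁻¹`; the last coefficient is the cofactor
      -- of `ζ'`, divided by `ζ`.
      linear_combination ((n + 1) * (1 - ζ) + b - a * ζ) * t1 + a * ζ * t2 - b * t3
        + P' * ((n + 1 + b) * ((n + 1) * (n + 1 + a + b) * P
          - (n + 1 + a) * (b * Q + (n + 1 + a) * ζ * P))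
          + a * b * (b * Q + (n + 1 + a) * ζ * P)) * hzz
    linear_combination (-D) * key - (n + 1 + a + b) * (((n + 1) * (1 - ζ) + b - a * ζ) * (P1 * P1')
        + a * ζ * (P1 * Q1') - b * (P1' * Q1)) * hd

/-! ### Confluent hypergeometric limits -/

/-- The exponential generating series `∑_k r_k z^k / k!`. With `r_k = (α)_k / (c)_k` this is the
confluent hypergeometric function `₁F₁(α; c; z)`. -/
noncomputable def expSeries (r : ℕ → ℂ) (z : ℂ) : ℂ := ∑' k : ℕ, r k * (z ^ k / k.factorial)

lemma norm_expSeries_term_le {r : ℕ → ℂ} {M : ℝ} (hr : ∀ k, ‖r k‖ ≤ M ^ k) {z : ℂ} {B : ℝ}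
    (hz : ‖z‖ ≤ B) (k : ℕ) : ‖r k * (z ^ k / k.factorial)‖ ≤ (M * B) ^ k / k.factorial := by
  rw [norm_mul, norm_div, norm_pow, Complex.norm_natCast, mul_pow, mul_div_assoc]
  have := hr k
  have h0 : 0 ≤ M ^ k := (norm_nonneg _).trans this
  gcongr

lemma hasSum_expSeries {r : ℕ → ℂ} {M : ℝ} (hr : ∀ k, ‖r k‖ ≤ M ^ k) (z : ℂ) :
    HasSum (fun k : ℕ => r k * (z ^ k / k.factorial)) (expSeries r z) :=
  (Summable.of_norm_bounded (Real.summable_pow_div_factorial (M * ‖z‖))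
    (norm_expSeries_term_le hr le_rfl)).hasSum

lemma norm_shift_le {r : ℕ → ℂ} {M : ℝ} (hr : ∀ k, ‖r k‖ ≤ M ^ k) :
    ∀ k, ‖r (k + 1)‖ ≤ M * M ^ k := fun k => by
  rw [← pow_succ']; exact hr _

lemma hasSum_expSeries_shift {r : ℕ → ℂ} {M : ℝ} (hr : ∀ k, ‖r k‖ ≤ M ^ k) (z : ℂ) :
    HasSum (fun k : ℕ => r (k + 1) * (z ^ k / k.factorial)) (expSeries (fun k => r (k + 1)) z) := by
  refine (Summable.of_norm_bounded ((Real.summable_pow_div_factorial (M * ‖z‖)).mul_left M)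
    fun k => ?_).hasSum
  rw [norm_mul, norm_div, norm_pow, Complex.norm_natCast, mul_pow, mul_div_assoc, ← mul_assoc]
  exact mul_le_mul_of_nonneg_right (norm_shift_le hr k) (by positivity)

lemma hasDerivAt_expSeries {r : ℕ → ℂ} {M : ℝ} (hM : 1 ≤ M) (hr : ∀ k, ‖r k‖ ≤ M ^ k) (z : ℂ) :
    HasDerivAt (expSeries r) (expSeries (fun k => r (k + 1)) z) z := by
  set B := ‖z‖ + 1 with hB
  have hM0 : 0 ≤ M := by linarith
  have hB0 : 0 ≤ B := by positivity
  have hu : Summable fun k : ℕ => M ^ k * (k * B ^ (k - 1) / k.factorial) := by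
    rw [← summable_nat_add_iff 1]
    refine ((Real.summable_pow_div_factorial (M * B)).mul_left M).congr fun k => ?_
    have h1 : ((k : ℝ) + 1) ≠ 0 := by positivity
    rw [Nat.factorial_succ, Nat.add_sub_cancel]
    push_cast
    field_simp
    rw [mul_pow]
    ring
  have h := hasDerivAt_tsum_of_isPreconnected hu Metric.isOpen_ball
    (convex_ball (0 : ℂ) B).isPreconnected
    (g := fun (k : ℕ) (y : ℂ) => r k * (y ^ k / k.factorial))
    (g' := fun (k : ℕ) (y : ℂ) => r k * (k * y ^ (k - 1) / k.factorial))
    (fun k y _ => ((hasDerivAt_pow k y).div_const _).const_mul _)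
    (fun k y hy => by
      have hy' : ‖y‖ ≤ B := (mem_ball_zero_iff.1 hy).le
      rw [norm_mul, norm_div, norm_mul, norm_pow, Complex.norm_natCast, Complex.norm_natCast]
      have := hr k
      gcongr)
    (y₀ := z) (y := z) (mem_ball_zero_iff.2 (by rw [hB]; linarith))
    (hasSum_expSeries hr z).summable (mem_ball_zero_iff.2 (by rw [hB]; linarith))
  refine h.congr_deriv ?_
  have hsucc : ∀ k : ℕ, r (k + 1) * (((k + 1 : ℕ) : ℂ) * z ^ (k + 1 - 1) / (k + 1).factorial)
      = r (k + 1) * (z ^ k / k.factorial) := fun k => by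
    have h1 : ((k : ℂ) + 1) ≠ 0 := by exact_mod_cast k.succ_ne_zero
    rw [Nat.factorial_succ, Nat.add_sub_cancel]
    push_cast
    field_simp
  have hs : Summable fun k : ℕ => r k * (k * z ^ (k - 1) / k.factorial) := by
    rw [← summable_nat_add_iff 1]
    exact (hasSum_expSeries_shift hr z).summable.congr fun k => (hsucc k).symm
  rw [hs.tsum_eq_zero_add]
  simp only [hsucc, expSeries]
  simp

/-- Multiplying the derivative by `z` multiplies the coefficients by the index. -/
lemma hasSum_mul_expSeries_shift {r : ℕ → ℂ} {M : ℝ} (hr : ∀ k, ‖r k‖ ≤ M ^ k)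
    (z : ℂ) : HasSum (fun k : ℕ => k * r k * (z ^ k / k.factorial))
      (z * expSeries (fun k => r (k + 1)) z) := by
  rw [← hasSum_nat_add_iff' 1]
  simp only [Finset.range_one, Finset.sum_singleton, Nat.cast_zero, zero_mul, sub_zero]
  refine ((hasSum_expSeries_shift hr z).mul_left z).congr_fun fun k => ?_
  have h1 : ((k : ℂ) + 1) ≠ 0 := by exact_mod_cast k.succ_ne_zero
  rw [Nat.factorial_succ]
  push_cast
  field_simp
  ring

lemma tendsto_choose_mul_cpow {y : ℕ → ℂ} {z : ℂ}
    (hy : Tendsto (fun N : ℕ => (N : ℂ) * y N) atTop (𝓝 z)) (k : ℕ) :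
    Tendsto (fun N : ℕ => (N.choose k : ℂ) * y N ^ k) atTop (𝓝 (z ^ k / k.factorial)) := by
  have h1 : Tendsto (fun n : ℕ => (n : ℝ) * (1 / n : ℝ)) atTop (𝓝 1) := by
    refine tendsto_const_nhds.congr' ?_
    filter_upwards [eventually_ge_atTop 1] with n hn
    have : (n : ℝ) ≠ 0 := by positivity
    field_simp
  have h2 := (Complex.continuous_ofReal.tendsto _).comp
    (ProbabilityTheory.tendsto_choose_mul_pow_atTop k h1)
  have h3 := h2.mul (hy.pow k)
  have e : ((((1 : ℝ) ^ k / k.factorial : ℝ)) : ℂ) * z ^ k = z ^ k / k.factorial := by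
    push_cast; ring
  have h3' : Tendsto (fun N : ℕ => ((((N.choose k : ℝ) * (1 / N : ℝ) ^ k : ℝ)) : ℂ) *
      ((N : ℂ) * y N) ^ k) atTop (𝓝 (z ^ k / k.factorial)) := by
    rw [← e]; exact h3
  refine h3'.congr' ?_
  filter_upwards [eventually_ge_atTop 1] with n hn
  have : (n : ℂ) ≠ 0 := by exact_mod_cast (by omega : n ≠ 0)
  have hpow := pow_ne_zero k this
  push_cast
  rw [mul_pow, one_div, inv_pow]
  field_simp

/-- The scaling limit of the terminating hypergeometric series at the singularity: if
`N (ζ_N - 1) → z` then `₂F₁(-N, α; c; 1 - ζ_N) → ₁F₁(α; c; z)`. -/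
lemma tendsto_hyperPoly {α c : ℂ} {M : ℝ} (hr : ∀ k, ‖pochRatio α c k‖ ≤ M ^ k) {ζ : ℕ → ℂ} {z : ℂ}
    (hζ : Tendsto (fun N : ℕ => (N : ℂ) * (ζ N - 1)) atTop (𝓝 z)) :
    Tendsto (fun N : ℕ => hyperPoly α c N (ζ N)) atTop (𝓝 (expSeries (pochRatio α c) z)) := by
  have hsum : ∀ N : ℕ, hyperPoly α c N (ζ N)
      = ∑' k : ℕ, pochRatio α c k * ((N.choose k : ℂ) * (ζ N - 1) ^ k) := by
    intro N
    rw [tsum_eq_sum (s := Finset.range (N + 1))]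
    · exact Finset.sum_congr rfl fun k _ => by ring
    · intro k hk
      rw [Finset.mem_range, not_lt] at hk
      rw [Nat.choose_eq_zero_of_lt (by omega)]; simp
  simp only [hsum, expSeries]
  refine tendsto_tsum_of_dominated_convergence
    (bound := fun k : ℕ => (M * (‖z‖ + 1)) ^ k / k.factorial)
    (Real.summable_pow_div_factorial _) (fun k => (tendsto_choose_mul_cpow hζ k).const_mul _) ?_
  filter_upwards [hζ.norm.eventually_lt_const (lt_add_one ‖z‖)] with N hN k
  have hb : ‖(N.choose k : ℂ) * (ζ N - 1) ^ k‖ ≤ (‖z‖ + 1) ^ k / k.factorial := by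
    have h1 : (N.choose k : ℝ) ≤ (N : ℝ) ^ k / k.factorial := Nat.choose_le_pow_div k N
    rw [norm_mul, norm_pow, Complex.norm_natCast]
    rw [norm_mul, Complex.norm_natCast] at hN
    calc (N.choose k : ℝ) * ‖ζ N - 1‖ ^ k ≤ (N : ℝ) ^ k / k.factorial * ‖ζ N - 1‖ ^ k := by gcongr
      _ = (N * ‖ζ N - 1‖) ^ k / k.factorial := by rw [mul_pow]; ring
      _ ≤ _ := by gcongr
  rw [norm_mul, mul_pow, mul_div_assoc]
  exact mul_le_mul (hr k) hb (norm_nonneg _) ((norm_nonneg _).trans (hr k))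

lemma norm_pochRatio_le (α : ℂ) {c : ℝ} (hc : 0 < c) (k : ℕ) :
    ‖pochRatio α c k‖ ≤ (‖α‖ / c + 1) ^ k := by
  rw [pochRatio, norm_prod, ← Finset.card_range k, ← Finset.prod_const, Finset.card_range]
  refine Finset.prod_le_prod (fun _ _ => norm_nonneg _) fun j _ => ?_
  have hj : (0 : ℝ) ≤ j := j.cast_nonneg
  have hcj : 0 < c + j := by linarith
  have e : (c + j : ℂ) = ((c + j : ℝ) : ℂ) := by push_cast; ring
  rw [norm_div, e, Complex.norm_real, Real.norm_of_nonneg hcj.le, div_le_iff₀ hcj]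
  have h1 : ‖α + (j : ℂ)‖ ≤ ‖α‖ + j := (norm_add_le _ _).trans (by simp)
  have h2 : 0 ≤ ‖α‖ / c * j := by positivity
  have h3 : ‖α‖ / c * c = ‖α‖ := by field_simp
  nlinarith

lemma pochRatio_mul_add {a c : ℂ} {k : ℕ} (hk : c + k ≠ 0) :
    pochRatio a c k * (a + k) = a * pochRatio (a + 1) c k := by
  have e := (pochRatio_succ a c k).symm.trans (pochRatio_succ' a c k)
  generalize pochRatio a c k = B at *
  generalize pochRatio (a + 1) c k = A at *
  field_simp at e
  exact e

/-- The limit `U(z) = ₁F₁(p - iq + 1; 2p + 1; z)` of the polynomials `P_N`. -/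
noncomputable def cJU (p q : ℝ) : ℂ → ℂ := expSeries (pochRatio (p - Complex.I * q + 1) (2 * p + 1))

/-- The limit `V(z) = ₁F₁(p - iq; 2p + 1; z)` of the polynomials `Q_N`. -/
noncomputable def cJV (p q : ℝ) : ℂ → ℂ := expSeries (pochRatio (p - Complex.I * q) (2 * p + 1))

lemma cJ_exists_bound {p : ℝ} (hp : -(1 / 2) < p) (α : ℂ) :
    ∃ M : ℝ, 1 ≤ M ∧ ∀ k, ‖pochRatio α (2 * p + 1) k‖ ≤ M ^ k := by
  have hc : 0 < 2 * p + 1 := by linarith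
  refine ⟨‖α‖ / (2 * p + 1) + 1, by
    have : 0 ≤ ‖α‖ / (2 * p + 1) := by positivity
    linarith, fun k => ?_⟩
  have := norm_pochRatio_le α hc k
  push_cast at this
  exact this

/-- The first order system `z U' = b V + (z - b) U`, `z V' = a (U - V)`, which is the limit of the
Szegő recursion; here it is read off the coefficients. -/
lemma cJ_exists_hasDerivAt {p : ℝ} (q : ℝ) (hp : -(1 / 2) < p) (z : ℂ) :
    ∃ U' V' : ℂ, HasDerivAt (cJU p q) U' z ∧ HasDerivAt (cJV p q) V' z ∧
      z * U' = (p + Complex.I * q) * cJV p q z + (z - (p + Complex.I * q)) * cJU p q z ∧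
      z * V' = (p - Complex.I * q) * (cJU p q z - cJV p q z) := by
  obtain ⟨M, hM, hA⟩ := cJ_exists_bound hp (p - Complex.I * q + 1)
  obtain ⟨M', hM', hB⟩ := cJ_exists_bound hp (p - Complex.I * q)
  refine ⟨_, _, hasDerivAt_expSeries hM hA z, hasDerivAt_expSeries hM' hB z, ?_, ?_⟩
  · have hU := hasSum_expSeries hA z
    have hV := hasSum_expSeries hB z
    have hzU : HasSum (fun k : ℕ => k * pochRatio (p - Complex.I * q + 1) (2 * p + 1) (k - 1) *
        (z ^ k / k.factorial)) (z * cJU p q z) := by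
      rw [← hasSum_nat_add_iff' 1]
      simp only [Finset.range_one, Finset.sum_singleton, Nat.cast_zero, zero_mul, sub_zero]
      refine (hU.mul_left z).congr_fun fun k => ?_
      have h1 : ((k : ℂ) + 1) ≠ 0 := by exact_mod_cast k.succ_ne_zero
      rw [Nat.factorial_succ, Nat.add_sub_cancel]
      push_cast
      field_simp
      ring
    refine (hasSum_mul_expSeries_shift hA z).unique ?_
    have := ((hV.mul_left (p + Complex.I * q)).add hzU).sub (hU.mul_left (p + Complex.I * q))
    have e : (p + Complex.I * q) * cJV p q z + (z - (p + Complex.I * q)) * cJU p q z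
        = (p + Complex.I * q) * cJV p q z + z * cJU p q z - (p + Complex.I * q) * cJU p q z := by
      ring
    rw [e]
    refine this.congr_fun fun k => ?_
    cases k with
    | zero => simp [pochRatio_zero]
    | succ k =>
      have hk := cJ_two_p_add_ne_zero hp k
      rw [pochRatio_succ' (p - Complex.I * q) _ k, pochRatio_succ (p - Complex.I * q + 1) _ k,
        Nat.add_sub_cancel]
      rw [← cJ_add_eq p q] at hk ⊢
      push_cast
      generalize (p - Complex.I * q : ℂ) = a at *
      generalize (p + Complex.I * q : ℂ) = b at *
      generalize pochRatio (a + 1) (a + b + 1) k = A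
      generalize z ^ (k + 1) / ((k + 1).factorial : ℂ) = Z
      field_simp
      ring
  · have hU := hasSum_expSeries hA z
    have hV := hasSum_expSeries hB z
    refine (hasSum_mul_expSeries_shift hB z).unique ?_
    refine ((hU.sub hV).mul_left (p - Complex.I * q)).congr_fun fun k => ?_
    have hk := cJ_two_p_add_ne_zero hp k
    have e := pochRatio_mul_add (a := p - Complex.I * q) hk
    linear_combination (z ^ k / k.factorial) * e

lemma tendsto_cJP {p : ℝ} (q : ℝ) (hp : -(1 / 2) < p) {ζ : ℕ → ℂ} {z : ℂ}
    (hζ : Tendsto (fun N : ℕ => (N : ℂ) * (ζ N - 1)) atTop (𝓝 z)) :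
    Tendsto (fun N : ℕ => cJP p q N (ζ N)) atTop (𝓝 (cJU p q z)) := by
  obtain ⟨M, -, hA⟩ := cJ_exists_bound hp (p - Complex.I * q + 1)
  exact tendsto_hyperPoly hA hζ

lemma tendsto_cJQ {p : ℝ} (q : ℝ) (hp : -(1 / 2) < p) {ζ : ℕ → ℂ} {z : ℂ}
    (hζ : Tendsto (fun N : ℕ => (N : ℂ) * (ζ N - 1)) atTop (𝓝 z)) :
    Tendsto (fun N : ℕ => cJQ p q N (ζ N)) atTop (𝓝 (cJV p q z)) := by
  obtain ⟨M, -, hA⟩ := cJ_exists_bound hp (p - Complex.I * q)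
  exact tendsto_hyperPoly hA hζ

/-- The point `e^{2πix/N}`, at scaled distance `x` from the singularity `ζ = 1`. -/
noncomputable def cJScaledNode (x : ℝ) (N : ℕ) : ℂ := Complex.exp (2 * Real.pi * x / N * Complex.I)

lemma norm_cJScaledNode (x : ℝ) (N : ℕ) : ‖cJScaledNode x N‖ = 1 := by
  have := Complex.norm_exp_ofReal_mul_I (2 * Real.pi * x / N)
  push_cast at this
  exact this

lemma tendsto_cJScaledNode (x : ℝ) :
    Tendsto (fun N : ℕ => (N : ℂ) * (cJScaledNode x N - 1)) atTop
      (𝓝 (2 * Complex.I * (Real.pi * x : ℝ))) := by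
  have hd : HasDerivAt (fun t : ℂ => Complex.exp (2 * Real.pi * x * t * Complex.I))
      (2 * Complex.I * (Real.pi * x : ℝ)) 0 := by
    have := (((hasDerivAt_id (0 : ℂ)).const_mul (2 * Real.pi * x : ℂ)).mul_const Complex.I).cexp
    refine this.congr_deriv ?_
    simp; ring
  have hs := hasDerivAt_iff_tendsto_slope_zero.1 hd
  have hN : Tendsto (fun N : ℕ => ((N : ℂ))⁻¹) atTop (𝓝[≠] 0) := by
    refine tendsto_nhdsWithin_iff.2 ⟨tendsto_inv_atTop_nhds_zero_nat, ?_⟩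
    filter_upwards [eventually_ge_atTop 1] with N hN
    have : (N : ℂ) ≠ 0 := by exact_mod_cast (by omega : N ≠ 0)
    exact inv_ne_zero this
  refine (hs.comp hN).congr fun N => ?_
  simp only [Function.comp, inv_inv, zero_add, mul_zero, zero_mul, Complex.exp_zero, smul_eq_mul,
    cJScaledNode, div_eq_mul_inv]

/-- On the imaginary axis the two limit functions have the same modulus, inherited from `P_N` and
`Q_N`. -/
lemma cJU_mul_conj_eq {p : ℝ} (q : ℝ) (hp : -(1 / 2) < p) (s : ℝ) :
    cJU p q (2 * Complex.I * s) * (starRingEnd ℂ) (cJU p q (2 * Complex.I * s))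
      = cJV p q (2 * Complex.I * s) * (starRingEnd ℂ) (cJV p q (2 * Complex.I * s)) := by
  have hζ := tendsto_cJScaledNode (s / Real.pi)
  rw [mul_div_cancel₀ s Real.pi_ne_zero] at hζ
  have hP := tendsto_cJP q hp hζ
  have hQ := tendsto_cJQ q hp hζ
  have hc := Complex.continuous_conj.tendsto
  refine tendsto_nhds_unique (hP.mul ((hc _).comp hP)) ?_
  refine (hQ.mul ((hc _).comp hQ)).congr fun N => ?_
  exact (cJP_mul_conj_eq q hp (norm_cJScaledNode _ N) N).symm

/-- `d_N` grows like `N^{2p} / Γ(2p+1)`. -/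
lemma tendsto_cJNormInv {p : ℝ} (hp : -(1 / 2) < p) :
    Tendsto (fun N : ℕ => cJNormInv p N / (N : ℝ) ^ (2 * p)) atTop
      (𝓝 (1 / Real.Gamma (2 * p + 1))) := by
  have hc : 0 < 2 * p + 1 := by linarith
  have hG := Real.Gamma_pos_of_pos hc
  have h1 : Tendsto (fun N : ℕ => (N : ℝ) / (N + (2 * p + 1))) atTop (𝓝 1) :=
    tendsto_natCast_div_add_atTop (2 * p + 1)
  have h2 := h1.div (Real.GammaSeq_tendsto_Gamma (2 * p + 1)) hG.ne'
  refine h2.congr' ?_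
  filter_upwards [eventually_ge_atTop 1] with N hN
  have hN0 : (0 : ℝ) < N := by exact_mod_cast hN
  have hne : (∏ j ∈ Finset.range N, (2 * p + 1 + (j : ℝ))) ≠ 0 :=
    Finset.prod_ne_zero_iff.2 fun j _ => by
      have : (0 : ℝ) ≤ j := j.cast_nonneg
      linarith
  have hne2 : (N : ℝ) + (2 * p + 1) ≠ 0 := by linarith
  have hpow : (N : ℝ) ^ (2 * p) ≠ 0 := (Real.rpow_pos_of_pos hN0 _).ne'
  have hf : (N.factorial : ℝ) ≠ 0 := by exact_mod_cast N.factorial_ne_zero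
  have e2 : cJNormInv p N = (∏ j ∈ Finset.range N, (2 * p + 1 + (j : ℝ))) / N.factorial := by
    rw [cJNormInv, Finset.prod_div_distrib, ← Finset.prod_range_add_one_eq_factorial]
    push_cast
    rfl
  simp only [Pi.div_apply]
  rw [Real.GammaSeq, Finset.prod_range_succ, e2, Real.rpow_add_one hN0.ne']
  have hne3 : 2 * p + 1 + (N : ℝ) ≠ 0 := by linarith
  field_simp
  ring

/-! ### The scaling limit of the density -/

/-- The limit of the diagonal kernel divided by `N d_N`: the summation formula for the
Christoffel–Darboux kernel with `P_N`, `Q_N` replaced by their limits `U`, `V`. -/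
noncomputable def cJProfile (p q s : ℝ) : ℝ :=
  ((s - q) * (cJU p q (2 * Complex.I * s) * (starRingEnd ℂ) (cJU p q (2 * Complex.I * s))).re
    - ((p - Complex.I * q) * (cJU p q (2 * Complex.I * s) *
        (starRingEnd ℂ) (cJV p q (2 * Complex.I * s)))).im) / s

/-- The limit of the remaining factor `2π d_N w / c₀` of the rescaled density. The weight tends
to a multiple of `|x|^{2p}` with different constants `e^{∓πq}` on the two sides of the
singularity. -/
noncomputable def cJPrefactor (p q x : ℝ) : ℝ :=
  2 * Real.pi * Real.exp (q * (-Real.pi * Real.sign x)) / cJMass p q *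
    (2 * Real.pi * |x|) ^ (2 * p) * (1 / Real.Gamma (2 * p + 1))

lemma cJProfile_ofReal (p q : ℝ) {s : ℝ} (hs : s ≠ 0) :
    (cJProfile p q s : ℂ) =
      ((-(2 * Complex.I * s) + (p + Complex.I * q) - (p - Complex.I * q)) *
          (cJU p q (2 * Complex.I * s) * (starRingEnd ℂ) (cJU p q (2 * Complex.I * s)))
        + (p - Complex.I * q) * (cJU p q (2 * Complex.I * s) *
          (starRingEnd ℂ) (cJV p q (2 * Complex.I * s)))
        - (p + Complex.I * q) * ((starRingEnd ℂ) (cJU p q (2 * Complex.I * s)) *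
          cJV p q (2 * Complex.I * s))) / (-(2 * Complex.I * s)) := by
  have hs' : (s : ℂ) ≠ 0 := by exact_mod_cast hs
  have h1 : (((cJU p q (2 * Complex.I * s) *
      (starRingEnd ℂ) (cJU p q (2 * Complex.I * s))).re : ℝ) : ℂ)
      = cJU p q (2 * Complex.I * s) * (starRingEnd ℂ) (cJU p q (2 * Complex.I * s)) := by
    rw [Complex.mul_conj]; simp
  have h2 := Complex.sub_conj ((p - Complex.I * q) * (cJU p q (2 * Complex.I * s) *
        (starRingEnd ℂ) (cJV p q (2 * Complex.I * s))))
  rw [map_mul, cJ_conj, map_mul, Complex.conj_conj] at h2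
  rw [cJProfile, Complex.ofReal_div, Complex.ofReal_sub, Complex.ofReal_mul, h1,
    div_eq_div_iff hs'
      (neg_ne_zero.2 (mul_ne_zero (mul_ne_zero two_ne_zero Complex.I_ne_zero) hs'))]
  push_cast at h2 ⊢
  linear_combination (-(s : ℂ)) * h2

lemma cJNode_scaled {x : ℝ} (hx : x ≠ 0) (N : ℕ) :
    cJNode (-Real.pi * Real.sign x + 2 * Real.pi * x / N) = cJScaledNode x N := by
  have h : Complex.exp (Complex.I * ((-Real.pi * Real.sign x : ℝ) : ℂ)) = -1 := by
    rcases lt_or_gt_of_ne hx with h | h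
    · rw [Real.sign_of_neg h]
      convert Complex.exp_pi_mul_I using 2
      push_cast
      ring
    · rw [Real.sign_of_pos h]
      convert Complex.exp_neg_pi_mul_I using 2
      push_cast
      ring
  rw [cJNode, Complex.ofReal_add, mul_add, Complex.exp_add, h, cJScaledNode]
  push_cast
  ring_nf

lemma cJWeight_eq_node (p q θ : ℝ) :
    cJWeight 2 p q θ = Real.exp (q * θ) * ‖cJNode θ - 1‖ ^ (2 * p) := by
  rw [cJWeight, cJNode, ← norm_neg (1 + _)]
  ring_nf

/-- The rescaled density as a product of factors each of which converges. -/
lemma cJRescaledDensity_eq {p : ℝ} (q : ℝ) (hp : -(1 / 2) < p) {x : ℝ} (hx : x ≠ 0) {N : ℕ}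
    (hN : 1 ≤ N) (hζ : cJScaledNode x N ≠ 1) :
    (cJRescaledDensity 2 p q N x : ℂ) =
      ((2 * Real.pi * Real.exp (q * (-Real.pi * Real.sign x + 2 * Real.pi * x / N)) / cJMass p q *
        ‖(N : ℂ) * (cJScaledNode x N - 1)‖ ^ (2 * p) *
        (cJNormInv p N / (N : ℝ) ^ (2 * p)) : ℝ) : ℂ) *
      (((-(N * (cJScaledNode x N - 1)) + (p + Complex.I * q)
          - (p - Complex.I * q) * cJScaledNode x N) *
          (cJP p q N (cJScaledNode x N) * (starRingEnd ℂ) (cJP p q N (cJScaledNode x N)))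
        + (p - Complex.I * q) * cJScaledNode x N *
          (cJP p q N (cJScaledNode x N) * (starRingEnd ℂ) (cJQ p q N (cJScaledNode x N)))
        - (p + Complex.I * q) * ((starRingEnd ℂ) (cJP p q N (cJScaledNode x N)) *
          cJQ p q N (cJScaledNode x N))) / (-(N * (cJScaledNode x N - 1)))) := by
  have hN0 : (0 : ℝ) < N := by exact_mod_cast hN
  have hNc : (N : ℂ) ≠ 0 := by exact_mod_cast hN0.ne'
  have hcd := cJ_christoffelDarboux q hp (norm_cJScaledNode x N) N
  have h1 : (1 - cJScaledNode x N) ≠ 0 := sub_ne_zero.2 hζ.symm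
  have hsub : cJScaledNode x N - 1 = -(1 - cJScaledNode x N) := by ring
  rw [mul_comm, ← eq_div_iff h1] at hcd
  rw [cJRescaledDensity, Complex.ofReal_mul, cJDensity_eq q hp, cJWeight_eq_node,
    cJNode_scaled hx, hcd, norm_mul, Complex.norm_natCast,
    Real.mul_rpow hN0.le (norm_nonneg _)]
  have hpow : ((((N : ℝ) ^ (2 * p) : ℝ)) : ℂ) ≠ 0 := by
    exact_mod_cast (Real.rpow_pos_of_pos hN0 _).ne'
  have hM : (cJMass p q : ℂ) ≠ 0 := by exact_mod_cast (cJMass_pos q hp).ne'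
  simp only [Complex.ofReal_mul, Complex.ofReal_div, Complex.ofReal_natCast]
  generalize (((N : ℝ) ^ (2 * p) : ℝ) : ℂ) = W at *
  generalize ((‖cJScaledNode x N - 1‖ ^ (2 * p) : ℝ) : ℂ) = Y
  rw [hsub]
  field_simp

lemma tendsto_cJRescaledDensity {p : ℝ} (q : ℝ) (hp : -(1 / 2) < p) {x : ℝ} (hx : x ≠ 0) :
    Tendsto (fun N : ℕ => cJRescaledDensity 2 p q N x) atTop
      (𝓝 (cJPrefactor p q x * cJProfile p q (Real.pi * x))) := by
  have hs : Real.pi * x ≠ 0 := mul_ne_zero Real.pi_ne_zero hx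
  set z : ℂ := 2 * Complex.I * (Real.pi * x : ℝ) with hz
  have hz0 : z ≠ 0 := mul_ne_zero (mul_ne_zero two_ne_zero Complex.I_ne_zero) (by exact_mod_cast hs)
  have hζ := tendsto_cJScaledNode x
  rw [← hz] at hζ
  have hP := tendsto_cJP q hp hζ
  have hQ := tendsto_cJQ q hp hζ
  have hP' := (Complex.continuous_conj.tendsto _).comp hP
  have hQ' := (Complex.continuous_conj.tendsto _).comp hQ
  have hinv : Tendsto (fun N : ℕ => ((N : ℂ))⁻¹) atTop (𝓝 0) := tendsto_inv_atTop_nhds_zero_nat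
  have hne : ∀ᶠ N : ℕ in atTop, 1 ≤ N ∧ cJScaledNode x N ≠ 1 := by
    filter_upwards [hζ.eventually_ne hz0, eventually_ge_atTop 1] with N h1 h2
    refine ⟨h2, fun h => h1 ?_⟩
    rw [h]; simp
  have hone : Tendsto (cJScaledNode x) atTop (𝓝 1) := by
    have h := (hinv.mul hζ).add_const 1
    rw [zero_mul, zero_add] at h
    refine h.congr' ?_
    filter_upwards [eventually_ge_atTop 1] with N hN
    have : (N : ℂ) ≠ 0 := by exact_mod_cast (by omega : N ≠ 0)
    field_simp
    ring
  have hker := (((((hζ.neg.add_const (p + Complex.I * q : ℂ)).sub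
    (hone.const_mul (p - Complex.I * q : ℂ))).mul (hP.mul hP')).add
    ((hone.const_mul (p - Complex.I * q : ℂ)).mul (hP.mul hQ'))).sub
    ((hP'.mul hQ).const_mul (p + Complex.I * q : ℂ))).div hζ.neg (neg_ne_zero.2 hz0)
  simp only [mul_one] at hker
  rw [hz, ← cJProfile_ofReal p q hs] at hker
  have hθ : Tendsto (fun N : ℕ => -Real.pi * Real.sign x + 2 * Real.pi * x / (N : ℝ)) atTop
      (𝓝 (-Real.pi * Real.sign x)) := by
    simpa using (tendsto_const_div_atTop_nhds_zero_nat (2 * Real.pi * x)).const_add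
      (-Real.pi * Real.sign x)
  have hexp := (Real.continuous_exp.tendsto _).comp (hθ.const_mul q)
  have hzn : ‖z‖ = 2 * Real.pi * |x| := by
    rw [hz, norm_mul, norm_mul, Complex.norm_I, Complex.norm_real, Real.norm_eq_abs, abs_mul,
      abs_of_pos Real.pi_pos]
    simp; ring
  have hwt : Tendsto (fun N : ℕ => ‖(N : ℂ) * (cJScaledNode x N - 1)‖ ^ (2 * p)) atTop
      (𝓝 ((2 * Real.pi * |x|) ^ (2 * p))) := by
    rw [← hzn]
    exact hζ.norm.rpow_const (Or.inl (norm_ne_zero_iff.2 hz0))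
  have hpre : Tendsto (fun N : ℕ =>
      2 * Real.pi * Real.exp (q * (-Real.pi * Real.sign x + 2 * Real.pi * x / N)) / cJMass p q *
        ‖(N : ℂ) * (cJScaledNode x N - 1)‖ ^ (2 * p) * (cJNormInv p N / (N : ℝ) ^ (2 * p))) atTop
      (𝓝 (cJPrefactor p q x)) :=
    (((hexp.const_mul (2 * Real.pi)).div_const (cJMass p q)).mul hwt).mul (tendsto_cJNormInv hp)
  have hall := ((Complex.continuous_ofReal.tendsto _).comp hpre).mul hker
  have hre := (Complex.continuous_re.tendsto _).comp hall
  rw [← Complex.ofReal_mul, Complex.ofReal_re] at hre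
  refine hre.congr' ?_
  filter_upwards [hne] with N hN
  have := cJRescaledDensity_eq q hp hx hN.1 hN.2
  exact (congrArg Complex.re this.symm).trans (Complex.ofReal_re _)

/-! ### The differential equation -/

lemma hasDerivAt_cJU_cJV {p : ℝ} (q : ℝ) (hp : -(1 / 2) < p) {s : ℝ} (hs : s ≠ 0) :
    HasDerivAt (fun s : ℝ => cJU p q (2 * Complex.I * s))
      (((p + Complex.I * q) * cJV p q (2 * Complex.I * s)
        + (2 * Complex.I * s - (p + Complex.I * q)) * cJU p q (2 * Complex.I * s)) / s) s ∧
    HasDerivAt (fun s : ℝ => cJV p q (2 * Complex.I * s))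
      ((p - Complex.I * q) *
        (cJU p q (2 * Complex.I * s) - cJV p q (2 * Complex.I * s)) / s) s := by
  obtain ⟨U', V', hU, hV, eU, eV⟩ := cJ_exists_hasDerivAt q hp (2 * Complex.I * s)
  have hs' : (s : ℂ) ≠ 0 := by exact_mod_cast hs
  have hlin : HasDerivAt (fun s : ℝ => (2 * Complex.I * s : ℂ)) (2 * Complex.I) s := by
    simpa using ((hasDerivAt_id (s : ℂ)).const_mul (2 * Complex.I)).comp_ofReal
  refine ⟨(hU.comp s hlin).congr_deriv ?_, (hV.comp s hlin).congr_deriv ?_⟩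
  · rw [eq_div_iff hs', ← eU]; ring
  · rw [eq_div_iff hs', ← eV]; ring

/-- With `H = |U|²` and `T = a U conj V`, both on the imaginary axis, the differential equations
of `U` and `V` close up on the three real functions `H`, `Re T`, `Im T`, because
`|V| = |U|`. -/
lemma hasDerivAt_normSq_cJU {p : ℝ} (q : ℝ) (hp : -(1 / 2) < p) {s : ℝ} (hs : s ≠ 0) :
    let H : ℝ → ℝ := fun s =>
      (cJU p q (2 * Complex.I * s) * (starRingEnd ℂ) (cJU p q (2 * Complex.I * s))).re
    let T : ℝ → ℂ := fun s => (p - Complex.I * q) * (cJU p q (2 * Complex.I * s) *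
        (starRingEnd ℂ) (cJV p q (2 * Complex.I * s)))
    HasDerivAt H ((2 * (T s).re - 2 * p * H s) / s) s ∧
    HasDerivAt (fun s => (T s).re)
      ((2 * (p ^ 2 + q ^ 2) * H s - 2 * (s - q) * (T s).im - 2 * p * (T s).re) / s) s ∧
    HasDerivAt (fun s => (T s).im) ((2 * (s - q) * (T s).re - 2 * p * (T s).im) / s) s := by
  intro H T
  have hs' : (s : ℂ) ≠ 0 := by exact_mod_cast hs
  obtain ⟨hU, hV⟩ := hasDerivAt_cJU_cJV q hp hs
  have hHc := hU.mul hU.star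
  have hTc := (hU.mul hV.star).const_mul (p - Complex.I * q : ℂ)
  have hmod := cJU_mul_conj_eq q hp s
  have hH' : ((H s : ℝ) : ℂ)
      = cJU p q (2 * Complex.I * s) * (starRingEnd ℂ) (cJU p q (2 * Complex.I * s)) := by
    simp only [H]
    rw [Complex.mul_conj]; simp
  have hTs : T s = (p - Complex.I * q) * (cJU p q (2 * Complex.I * s) *
        (starRingEnd ℂ) (cJV p q (2 * Complex.I * s))) := rfl
  have hTconj : (starRingEnd ℂ) (T s) = (p + Complex.I * q) *
      ((starRingEnd ℂ) (cJU p q (2 * Complex.I * s)) * cJV p q (2 * Complex.I * s)) := by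
    rw [hTs, map_mul, cJ_conj, map_mul, Complex.conj_conj]
  have hH2 : HasDerivAt (fun s : ℝ => cJU p q (2 * Complex.I * s) *
      (starRingEnd ℂ) (cJU p q (2 * Complex.I * s)))
      (((2 * (T s).re - 2 * p * H s) / s : ℝ) : ℂ) s := by
    refine hHc.congr_deriv ?_
    have h2 : (2 * ((T s).re : ℂ)) = T s + (starRingEnd ℂ) (T s) := by
      rw [Complex.add_conj]; push_cast; ring
    push_cast
    rw [h2, hH', hTconj, hTs]
    simp only [← starRingEnd_apply, map_div₀, map_add, map_sub, map_mul, Complex.conj_ofReal,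
      Complex.conj_I, Complex.conj_ofNat]
    field_simp
    ring
  have hT2 : HasDerivAt T ((2 * (p ^ 2 + q ^ 2) * H s
      + (2 * Complex.I * (s - q) - 2 * p) * T s) / s) s := by
    refine hTc.congr_deriv ?_
    rw [hH', hTs]
    simp only [← starRingEnd_apply, map_div₀, map_sub, map_mul, Complex.conj_ofReal,
      Complex.conj_I]
    generalize (starRingEnd ℂ) (cJV p q (2 * Complex.I * s)) = V' at *
    generalize (starRingEnd ℂ) (cJU p q (2 * Complex.I * s)) = U' at *
    generalize cJV p q (2 * Complex.I * s) = V at *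
    generalize cJU p q (2 * Complex.I * s) = U at *
    have hI := Complex.I_sq
    field_simp
    linear_combination (-(p - Complex.I * q) * (p + Complex.I * q)) * hmod
      - (2 * q ^ 2 * U * U') * hI
  have hre : ∀ {f : ℝ → ℂ} {f' : ℂ}, HasDerivAt f f' s →
      HasDerivAt (fun s => (f s).re) f'.re s := fun h =>
    Complex.reCLM.hasFDerivAt.comp_hasDerivAt s h
  have him : ∀ {f : ℝ → ℂ} {f' : ℂ}, HasDerivAt f f' s →
      HasDerivAt (fun s => (f s).im) f'.im s := fun h =>
    Complex.imCLM.hasFDerivAt.comp_hasDerivAt s h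
  refine ⟨(hre hH2).congr_deriv (Complex.ofReal_re _), (hre hT2).congr_deriv ?_,
    (him hT2).congr_deriv ?_⟩
  · rw [Complex.div_ofReal_re]
    congr 1
    simp [pow_two]
    ring
  · rw [Complex.div_ofReal_im]
    congr 1
    simp [pow_two]
    ring

/-- If `g`, `T₁`, `T₂` solve the linear system below and `x R = (x - q) g - T₂`, then `x R` is a
primitive of `g`, and eliminating `g`, `T₁`, `T₂` leaves a third order equation for `R`. -/
lemma thirdOrder_of_system {p q : ℝ} {g T₁ T₂ R : ℝ → ℝ}
    (hg : ∀ x ≠ 0, HasDerivAt g (2 * T₁ x / x) x)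
    (h₁ : ∀ x ≠ 0, HasDerivAt T₁ ((2 * (p ^ 2 + q ^ 2) * g x - 2 * (x - q) * T₂ x) / x) x)
    (h₂ : ∀ x ≠ 0, HasDerivAt T₂ (2 * (x - q) * T₁ x / x) x)
    (hR : ∀ x ≠ 0, R x = ((x - q) * g x - T₂ x) / x) :
    ContDiffOn ℝ 3 R {x : ℝ | x ≠ 0} ∧ ∀ x : ℝ, x ≠ 0 →
      x ^ 3 * iteratedDeriv 3 R x + 4 * x ^ 2 * iteratedDeriv 2 R x
        + 2 * x * (1 - 2 * p ^ 2 - 4 * q * x + 2 * x ^ 2) * deriv R x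
        - 4 * (p ^ 2 + q * x) * R x = 0 := by
  have hopen : IsOpen {x : ℝ | x ≠ 0} := isOpen_ne
  -- `R1`, `R2`, `R3` are the successive derivatives of `R`; the first is `(x R)' = g`, solved
  -- for `R'`.
  set R1 : ℝ → ℝ := fun x => (g x - R x) / x with hR1
  set R2 : ℝ → ℝ := fun x => (2 * T₁ x / x - 2 * R1 x) / x with hR2
  set R3 : ℝ → ℝ := fun x => ((2 * ((2 * (p ^ 2 + q ^ 2) * g x - 2 * (x - q) * T₂ x) / x) * x
      - 2 * T₁ x) / x ^ 2 - 2 * R2 x) / x - (2 * T₁ x / x - 2 * R1 x) / x ^ 2 with hR3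
  have d0 : ∀ x ≠ 0, HasDerivAt R (R1 x) x := by
    intro x hx
    have h := ((((hasDerivAt_id x).sub_const q).mul (hg x hx)).sub (h₂ x hx)).div
      (hasDerivAt_id x) hx
    have h' := h.congr_of_eventuallyEq (f₁ := R)
      ((hopen.eventually_mem hx).mono fun y hy => hR y hy)
    refine h'.congr_deriv ?_
    simp only [hR1, hR x hx, id, Pi.mul_apply, Pi.sub_apply]
    field_simp
    ring
  have d1 : ∀ x ≠ 0, HasDerivAt R1 (R2 x) x := by
    intro x hx
    have h := ((hg x hx).sub (d0 x hx)).div (hasDerivAt_id x) hx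
    refine h.congr_deriv ?_
    simp only [hR2, hR1, id, Pi.sub_apply]
    field_simp
    ring
  have d2 : ∀ x ≠ 0, HasDerivAt R2 (R3 x) x := by
    intro x hx
    have h := ((((h₁ x hx).const_mul 2).div (hasDerivAt_id x) hx).sub
      ((d1 x hx).const_mul 2)).div (hasDerivAt_id x) hx
    refine h.congr_deriv ?_
    simp only [hR3, id, Pi.sub_apply, Pi.div_apply]
    field_simp
  have e1 : ∀ x ≠ 0, deriv R x = R1 x := fun x hx => (d0 x hx).deriv
  have e2 : ∀ x ≠ 0, deriv (deriv R) x = R2 x := fun x hx => by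
    rw [(show deriv R =ᶠ[𝓝 x] R1 from (hopen.eventually_mem hx).mono e1).deriv_eq,
      (d1 x hx).deriv]
  have e3 : ∀ x ≠ 0, deriv (deriv (deriv R)) x = R3 x := fun x hx => by
    rw [(show deriv (deriv R) =ᶠ[𝓝 x] R2 from (hopen.eventually_mem hx).mono e2).deriv_eq,
      (d2 x hx).deriv]
  have cont : ∀ {f f' : ℝ → ℝ}, (∀ x ≠ 0, HasDerivAt f (f' x) x) →
      ContinuousOn f {x : ℝ | x ≠ 0} := fun h x hx => (h x hx).continuousAt.continuousWithinAt
  have step : ∀ {n : WithTop ℕ∞} {f f' : ℝ → ℝ}, n ≠ ⊤ → (∀ x ≠ 0, HasDerivAt f (f' x) x) →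
      ContDiffOn ℝ n f' {x : ℝ | x ≠ 0} → ContDiffOn ℝ (n + 1) f {x : ℝ | x ≠ 0} := by
    intro n f f' hn h hf'
    refine (contDiffOn_succ_iff_deriv_of_isOpen hopen).2
      ⟨fun x hx => (h x hx).differentiableAt.differentiableWithinAt, fun hh => absurd hh hn, ?_⟩
    exact hf'.congr fun x hx => (h x hx).deriv
  refine ⟨?_, fun x hx => ?_⟩
  · have c3 : ContDiffOn ℝ 0 R3 {x : ℝ | x ≠ 0} := by
      rw [contDiffOn_zero]
      have cg := cont hg
      have c1 := cont h₁
      have c2 := cont h₂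
      have cR1 := cont d1
      have cR2 := cont d2
      have hid : ∀ x ∈ {x : ℝ | x ≠ 0}, x ≠ 0 := fun x hx => hx
      have hid2 : ∀ x ∈ {x : ℝ | x ≠ 0}, x ^ 2 ≠ 0 := fun x hx => pow_ne_zero 2 hx
      simp only [hR3]
      fun_prop (disch := assumption)
    have c2 := step (n := 0) (by simp) d2 c3
    have c1 := step (n := 0 + 1) (by decide) d1 c2
    have c0 := step (n := 0 + 1 + 1) (by decide) d0 c1
    convert c0 using 1
    norm_num
  · rw [iteratedDeriv_succ, iteratedDeriv_succ, iteratedDeriv_one, e3 x hx, e2 x hx, e1 x hx]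
    simp only [hR3, hR2, hR1, hR x hx]
    field_simp
    ring

lemma cJScaledDensity_eq {p : ℝ} (q : ℝ) (hp : -(1 / 2) < p) {x : ℝ} (hx : x ≠ 0) :
    cJScaledDensity 2 p q x
      = 1 / Real.pi * cJPrefactor p q (x / Real.pi) * cJProfile p q x := by
  have h := tendsto_cJRescaledDensity q hp (div_ne_zero hx Real.pi_ne_zero)
  rw [cJScaledDensity, cJBulkDensity, h.limUnder_eq, mul_div_cancel₀ x Real.pi_ne_zero, mul_assoc]

/-- The prefactor is, on each half-line, a constant multiple of `|x|^{2p}`. -/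
lemma hasDerivAt_cJPrefactor (p q : ℝ) {x : ℝ} (hx : x ≠ 0) :
    HasDerivAt (fun x => 1 / Real.pi * cJPrefactor p q (x / Real.pi))
      (2 * p * (1 / Real.pi * cJPrefactor p q (x / Real.pi)) / x) x := by
  have hπ := Real.pi_pos
  have hsign : ∀ᶠ y in 𝓝 x, Real.sign (y / Real.pi) = Real.sign (x / Real.pi) := by
    rcases lt_or_gt_of_ne hx with h | h
    · filter_upwards [eventually_lt_nhds h] with y hy
      rw [Real.sign_of_neg (div_neg_of_neg_of_pos hy hπ),
        Real.sign_of_neg (div_neg_of_neg_of_pos h hπ)]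
    · filter_upwards [eventually_gt_nhds h] with y hy
      rw [Real.sign_of_pos (div_pos hy hπ), Real.sign_of_pos (div_pos h hπ)]
  have habs : HasDerivAt (fun y : ℝ => (2 * Real.pi * |y / Real.pi|) ^ (2 * p))
      (2 * p * (2 * Real.pi * |x / Real.pi|) ^ (2 * p) / x) x := by
    have e : ∀ y : ℝ, 2 * Real.pi * |y / Real.pi| = 2 * |y| := fun y => by
      rw [abs_div, abs_of_pos hπ]; field_simp
    simp only [e]
    have hx2 : (2 * |x|) ≠ 0 := by positivity
    have h := ((hasDerivAt_abs hx).const_mul 2).rpow_const (p := 2 * p) (Or.inl hx2)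
    refine h.congr_deriv ?_
    rw [Real.rpow_sub_one hx2]
    have hsx : (SignType.sign x : ℝ) * x = |x| := sign_mul_self x
    have hs2 : (SignType.sign x : ℝ) / |x| = 1 / x := by
      rw [div_eq_div_iff (abs_pos.2 hx).ne' hx, hsx, one_mul]
    have hx3 : |x| ≠ 0 := (abs_pos.2 hx).ne'
    rw [div_eq_div_iff hx3 hx] at hs2
    field_simp
    linear_combination p * hs2
  have h := (habs.const_mul (1 / Real.pi * (2 * Real.pi *
    Real.exp (q * (-Real.pi * Real.sign (x / Real.pi))) / cJMass p q))).mul_const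
    (1 / Real.Gamma (2 * p + 1))
  have h' := h.congr_of_eventuallyEq
    (f₁ := fun x => 1 / Real.pi * cJPrefactor p q (x / Real.pi)) (hsign.mono fun y hy => by
      simp only [cJPrefactor, hy]; ring)
  refine h'.congr_deriv ?_
  rw [cJPrefactor]
  ring

theorem propositionP2p9 (p q : ℝ) (hp : -(1 / 2) < p) :
    (∀ x : ℝ, x ≠ 0 →
      Tendsto (fun N : ℕ => cJRescaledDensity 2 p q N x) atTop (𝓝 (cJBulkDensity 2 p q x))) ∧
    ContDiffOn ℝ 3 (cJScaledDensity 2 p q) {x : ℝ | x ≠ 0} ∧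
    ∀ x : ℝ, x ≠ 0 →
      x ^ 3 * iteratedDeriv 3 (cJScaledDensity 2 p q) x
        + 4 * x ^ 2 * iteratedDeriv 2 (cJScaledDensity 2 p q) x
        + 2 * x * (1 - 2 * p ^ 2 - 4 * q * x + 2 * x ^ 2) * deriv (cJScaledDensity 2 p q) x
        - 4 * (p ^ 2 + q * x) * cJScaledDensity 2 p q x = 0 := by
  refine ⟨fun x hx => ?_, ?_⟩
  · have h := tendsto_cJRescaledDensity q hp hx
    rw [cJBulkDensity, h.limUnder_eq]
    exact h
  · set E : ℝ → ℝ := fun x => 1 / Real.pi * cJPrefactor p q (x / Real.pi) with hE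
    set H : ℝ → ℝ := fun s =>
      (cJU p q (2 * Complex.I * s) * (starRingEnd ℂ) (cJU p q (2 * Complex.I * s))).re with hH
    set T : ℝ → ℂ := fun s => (p - Complex.I * q) * (cJU p q (2 * Complex.I * s) *
        (starRingEnd ℂ) (cJV p q (2 * Complex.I * s))) with hT
    have dE : ∀ x ≠ 0, HasDerivAt E (2 * p * E x / x) x := fun x hx =>
      hasDerivAt_cJPrefactor p q hx
    have d := fun (x : ℝ) (hx : x ≠ 0) => hasDerivAt_normSq_cJU q hp hx
    -- The factor `E ~ |x|^{2p}` absorbs the terms with coefficient `-2p` of the system.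
    refine thirdOrder_of_system (g := fun x => E x * H x) (T₁ := fun x => E x * (T x).re)
      (T₂ := fun x => E x * (T x).im) (fun x hx => ?_) (fun x hx => ?_) (fun x hx => ?_)
      (fun x hx => ?_)
    · refine ((dE x hx).mul (d x hx).1).congr_deriv ?_
      simp only [hT]
      field_simp
      ring
    · refine ((dE x hx).mul (d x hx).2.1).congr_deriv ?_
      simp only [hH, hT]
      field_simp
      ring
    · refine ((dE x hx).mul (d x hx).2.2).congr_deriv ?_
      simp only [hT]
      field_simp
      ring
    · rw [cJScaledDensity_eq q hp hx, cJProfile]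
      simp only [hE, hH, hT]
      ring
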